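/- Let $\gamma\in(0,1)$, $\mu_{\mathsf T}\in\mathbb C$, $\sigma_{\mathsf T}^2\ge 0$. Let $X$ be a complex random variable with the Bernoulli--Gaussian law $(1-\gamma)\,\delta_0+\gamma\,\mathcal{CN}(\mu_{\mathsf T},\sigma_{\mathsf T}^2)$, where $\mathcal{CN}(\mu,\sigma^2)$ is the law of a complex variable whose real and imaginary parts are independent Gaussians with means $\operatorname{Re}\mu,\operatorname{Im}\mu$ and variance $\sigma^2/2$ each. Let $Z\sim\mathcal{CN}(0,1)$ be independent of $X$, and for $s\ge 0$ put $Y_s=\sqrt{s}\,X+Z$ and $$\mathsf{mmse}(s)=\mathbb E\big[\,|X-\mathbb E[X\mid Y_s]|^2\,\big].$$ Then for every $\mathsf{snr}\ge 0$ the sensing rate of the range--Doppler bin, i.e. the mutual information in bits, $I(X;Y_{\mathsf{snr}})=\mathbb E\left[\log_2\frac{dP_{XY_{\mathsf{snr}}}}{d(P_X\otimes P_{Y_{\mathsf{snr}}})}(X,Y_{\mathsf{snr}})\right]$, is finite, $\mathsf{mmse}$ is integrable on $[0,\mathsf{snr}]$, and $$I(X;Y_{\mathsf{snr}})=\log_2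 e\int_0^{\mathsf{snr}}\mathsf{mmse}(s)\,ds .$$ Here, for every $s\ge 0$, $$\mathsf{mmse}(s)=\int_{\mathbb C}\Big\{\hat\gamma_s(y)\,(1-\hat\gamma_s(y))\,|\hat\mu_s(y)|^2+\hat\gamma_s(y)\,\frac{\sigma_{\mathsf T}^2}{1+s\sigma_{\mathsf T}^2}\Big\}\,f_s(y)\,dy,$$ with $$\hat\mu_s(y)=\mu_{\mathsf T}+\frac{\sqrt s\,\sigma_{\mathsf T}^2}{1+s\sigma_{\mathsf T}^2}\,(y-\sqrt s\,\mu_{\mathsf T}),$$ $$\hat\gamma_s(y)=\Big[1+\frac{1-\gamma}{\gamma}\,(s\sigma_{\mathsf T}^2+1)\,e^{-|y|^2+\frac{|y-\sqrt s\,\mu_{\mathsf T}|^2}{s\sigma_{\mathsf T}^2+1}}\Big]^{-1},$$ $$f_s(y)=\frac{1-\gamma}{\pi}\,e^{-|y|^2}+\frac{\gamma}{\pi(s\sigma_{\mathsf T}^2+1)}\,e^{-\frac{|y-\sqrt s\,\mu_{\mathsf T}|^2}{s\sigma_{\mathsf T}^2+1}} .$$ -/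

import Mathlib

open MeasureTheory ProbabilityTheory InformationTheory
open scoped ENNReal NNReal

noncomputable section

/-- The circularly-symmetric complex Gaussian law `CN(m, v)`: independent real and imaginary
parts, each of variance `v / 2`, centred at `m.re` and `m.im`. -/
def complexGaussian (m : ℂ) (v : ℝ≥0) : Measure ℂ :=
  ((gaussianReal m.re (v / 2)).prod (gaussianReal m.im (v / 2))).map
    Complex.measurableEquivRealProd.symm

/-- The Bernoulli-Gaussian law `BG(m, v, γ) = (1 - γ) δ₀ + γ CN(m, v)`. -/
def bernoulliGaussian (m : ℂ) (v : ℝ≥0) (γ : ℝ) : Measure ℂ :=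
  ENNReal.ofReal (1 - γ) • Measure.dirac 0 + ENNReal.ofReal γ • complexGaussian m v

/-- The observation `√s X + Z` at signal-to-noise ratio `s`. -/
def awgnObservation {Ω : Type*} (X Z : Ω → ℂ) (s : ℝ) : Ω → ℂ :=
  fun ω => (Real.sqrt s : ℂ) * X ω + Z ω

/-- The mutual information `I(X;Y)` in bits: the relative entropy of the joint law with respect
to the product of the marginal laws (`klDiv` is in nats; one nat is `log₂ e` bits). -/
def mutualInfoBits {Ω : Type*} [MeasurableSpace Ω] (P : Measure Ω) (X Y : Ω → ℂ) : ℝ≥0∞ :=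
  ENNReal.ofReal (Real.logb 2 (Real.exp 1)) *
    klDiv (P.map (fun ω => (X ω, Y ω))) ((P.map X).prod (P.map Y))

/-- The mean square error `E |X - E[X | Y]|²` of the conditional-mean estimator. -/
def mmse {Ω : Type*} [MeasurableSpace Ω] (P : Measure Ω) (X Y : Ω → ℂ) : ℝ :=
  ∫ ω, ‖X ω - (P[X | MeasurableSpace.comap Y inferInstance]) ω‖ ^ 2 ∂P

/-- The posterior mean of `X` given `Y = y` and given that the target is present. -/
def bgPosteriorMean (m : ℂ) (v : ℝ≥0) (s : ℝ) (y : ℂ) : ℂ :=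
  m + ((Real.sqrt s * v / (1 + s * v) : ℝ) : ℂ) * (y - (Real.sqrt s : ℂ) * m)

/-- The posterior probability, given `Y = y`, that the target is present. -/
def bgPosteriorProb (m : ℂ) (v : ℝ≥0) (γ s : ℝ) (y : ℂ) : ℝ :=
  (1 + (1 - γ) / γ * (s * v + 1) *
    Real.exp (-‖y‖ ^ 2 + ‖y - (Real.sqrt s : ℂ) * m‖ ^ 2 / (s * v + 1)))⁻¹

/-- The density of `Y`. -/
def bgObservationPDF (m : ℂ) (v : ℝ≥0) (γ s : ℝ) (y : ℂ) : ℝ :=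
  (1 - γ) * (1 / Real.pi * Real.exp (-‖y‖ ^ 2)) +
    γ * (1 / (Real.pi * (s * v + 1)) *
      Real.exp (-(‖y - (Real.sqrt s : ℂ) * m‖ ^ 2 / (s * v + 1))))

/-- The explicit integral expression of the MMSE of a Bernoulli-Gaussian signal. -/
def bgMmseIntegral (m : ℂ) (v : ℝ≥0) (γ s : ℝ) : ℝ :=
  ∫ y : ℂ, (bgPosteriorProb m v γ s y * (1 - bgPosteriorProb m v γ s y) *
      ‖bgPosteriorMean m v s y‖ ^ 2 +
    bgPosteriorProb m v γ s y * (v / (1 + s * v))) * bgObservationPDF m v γ s y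

end

/-! The proof works with the amplitude `a = √s`. Write `f₀`, `f₁` for the densities of `CN(0, 1)`
and `CN(a m, a² v + 1)`, `f = (1 - γ) f₀ + γ f₁` for the density of `Y`, `w = γ f₁ / f` for the
posterior weight and `μ` for the Gaussian posterior mean. Put `c = a² v + 1` and `L(a) = E[log
f(Y)]`.

Given `X`, the log-density of `Y` is `-log π - |Z|²`, whose mean is `L(0)`. Hence the information in
nats is `L(0) - L(a)` (`klDiv_bernoulliGaussian`), and the theorem reduces to `L'(a) = -2 a · mmse`
(`hasDerivAt_expectedLogPDF`), followed by the substitution `t = a²`.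

To differentiate `L`, both mixture components are expressed as integrals against the fixed law
`CN(0, 1)`: the null component directly, the Gaussian one along the path `a m + √c z`. The null
component yields `w ∂ₐ log f₁`. The identity `(1 - γ) f₀ w = γ f₁ (1 - w)` moves this term to the
Gaussian component, where it joins the derivative of `log f₀` along the path; the sum of the two
scores collapses to `-2a|μ|² - 2av/c` (`scoreFixed_gaussianPath`). No integration by parts is
needed.

On the estimation side, Gaussian conjugacy makes the posterior a mixture of `δ₀` and `CN(μ, v/c)`
with weights `1 - w` and `w`. Its mean is `w μ` and its variance `w (1 - w)|μ|² + w v/c`;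
integrating against `f` and using `w f = γ f₁` gives the same expression (`mmse_eq_amplitudeMmse`).
-/

/-! ### Complex Gaussian laws: densities, affine images, moments -/

/-- The density of `CN(m, c)` with respect to Lebesgue measure on `ℂ`. -/
noncomputable def complexGaussianPDF (m : ℂ) (c : ℝ) (y : ℂ) : ℝ :=
  1 / (Real.pi * c) * Real.exp (-(‖y - m‖ ^ 2 / c))

lemma complexGaussianPDF_nonneg (m : ℂ) {c : ℝ} (hc : 0 ≤ c) (y : ℂ) :
    0 ≤ complexGaussianPDF m c y := by
  unfold complexGaussianPDF; positivity

lemma complexGaussianPDF_pos (m : ℂ) {c : ℝ} (hc : 0 < c) (y : ℂ) :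
    0 < complexGaussianPDF m c y := by
  unfold complexGaussianPDF; positivity

@[fun_prop]
lemma measurable_complexGaussianPDF (m : ℂ) (c : ℝ) : Measurable (complexGaussianPDF m c) := by
  unfold complexGaussianPDF; fun_prop

lemma measurable_uncurry_complexGaussianPDF (a : ℝ) :
    Measurable fun p : ℂ × ℂ => complexGaussianPDF (a * p.1) 1 p.2 := by
  unfold complexGaussianPDF; fun_prop

lemma measurable_ofReal_complexGaussianPDF_mul (a : ℝ) (y : ℂ) :
    Measurable fun x : ℂ => ENNReal.ofReal (complexGaussianPDF (a * x) 1 y) := by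
  unfold complexGaussianPDF; fun_prop

instance (m : ℂ) (v : ℝ≥0) : IsProbabilityMeasure (complexGaussian m v) := by
  unfold complexGaussian
  exact Measure.isProbabilityMeasure_map (by fun_prop)

lemma complexGaussian_zero_var (m : ℂ) : complexGaussian m 0 = Measure.dirac m := by
  unfold complexGaussian
  rw [zero_div, gaussianReal_zero_var, gaussianReal_zero_var, Measure.dirac_prod_dirac,
    Measure.map_dirac' (by fun_prop)]
  rfl

lemma norm_sub_sq_eq (y m : ℂ) : ‖y - m‖ ^ 2 = (y.re - m.re) ^ 2 + (y.im - m.im) ^ 2 := by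
  rw [← Complex.normSq_eq_norm_sq, Complex.normSq_apply]
  simp only [Complex.sub_re, Complex.sub_im]
  ring

lemma gaussianPDFReal_mul_gaussianPDFReal (m y : ℂ) (v : ℝ≥0) (hv : v ≠ 0) :
    gaussianPDFReal m.re (v / 2) y.re * gaussianPDFReal m.im (v / 2) y.im =
      complexGaussianPDF m v y := by
  have hv' : (0 : ℝ) < v := by positivity
  unfold gaussianPDFReal complexGaussianPDF
  have h2 : (((v / 2 : ℝ≥0) : ℝ)) = v / 2 := by simp
  rw [h2, mul_mul_mul_comm, ← Real.exp_add, ← mul_inv,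
    Real.mul_self_sqrt (by positivity), norm_sub_sq_eq]
  congr 1
  · rw [one_div]; congr 1; ring
  · congr 1; field_simp; ring

lemma complexGaussian_eq_withDensity (m : ℂ) {v : ℝ≥0} (hv : v ≠ 0) :
    complexGaussian m v =
      volume.withDensity (fun y => ENNReal.ofReal (complexGaussianPDF m v y)) := by
  have hv2 : v / 2 ≠ 0 := by positivity
  unfold complexGaussian
  rw [gaussianReal_of_var_ne_zero _ hv2, gaussianReal_of_var_ne_zero _ hv2,
    prod_withDensity (by fun_prop) (by fun_prop)]
  refine Measure.ext_of_lintegral _ fun f hf => ?_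
  rw [lintegral_map hf (by fun_prop), lintegral_withDensity_eq_lintegral_mul _ (by fun_prop)
    (by fun_prop), lintegral_withDensity_eq_lintegral_mul _ (by fun_prop) (by fun_prop),
    ← Measure.volume_eq_prod, ← Complex.volume_preserving_equiv_real_prod.symm.lintegral_comp
      (by fun_prop)]
  refine lintegral_congr fun z => ?_
  simp only [Pi.mul_apply]
  rw [← gaussianPDFReal_mul_gaussianPDFReal _ _ _ hv,
    ENNReal.ofReal_mul (gaussianPDFReal_nonneg _ _ _)]
  rfl

/-- This turns an integral against a parameter-dependent Gaussian into one against a fixed measure,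
so that the parameter can be differentiated inside the integrand. The degenerate case `v = 0` is
included. -/
lemma complexGaussian_eq_map (m : ℂ) (v : ℝ≥0) :
    complexGaussian m v = (complexGaussian 0 1).map (fun z => m + (Real.sqrt v : ℂ) * z) := by
  have key : ∀ t : ℝ, gaussianReal t (v / 2) =
      (gaussianReal 0 (1 / 2)).map (fun x => t + Real.sqrt v * x) := by
    intro t
    have : (fun x => t + Real.sqrt v * x) = (fun x => t + x) ∘ (fun x => Real.sqrt v * x) := rfl
    rw [this, ← Measure.map_map (by fun_prop) (by fun_prop), gaussianReal_map_const_mul,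
      gaussianReal_map_const_add]
    congr 1
    · simp
    · ext; simp [div_eq_mul_inv]
  unfold complexGaussian
  rw [key m.re, key m.im, Measure.map_prod_map _ _ (by fun_prop) (by fun_prop),
    Measure.map_map (by fun_prop) (by fun_prop), Measure.map_map (by fun_prop) (by fun_prop)]
  congr 1
  ext z
  apply Complex.ext <;> simp [Complex.measurableEquivRealProd_symm_apply]

lemma map_re_complexGaussian (m : ℂ) (v : ℝ≥0) :
    (complexGaussian m v).map Complex.re = gaussianReal m.re (v / 2) := by
  unfold complexGaussian
  rw [Measure.map_map (by fun_prop) (by fun_prop)]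
  have : Complex.re ∘ Complex.measurableEquivRealProd.symm = Prod.fst := by
    ext z; simp [Complex.measurableEquivRealProd_symm_apply]
  rw [this, Measure.map_fst_prod]; simp

lemma map_im_complexGaussian (m : ℂ) (v : ℝ≥0) :
    (complexGaussian m v).map Complex.im = gaussianReal m.im (v / 2) := by
  unfold complexGaussian
  rw [Measure.map_map (by fun_prop) (by fun_prop)]
  have : Complex.im ∘ Complex.measurableEquivRealProd.symm = Prod.snd := by
    ext z; simp [Complex.measurableEquivRealProd_symm_apply]
  rw [this, Measure.map_snd_prod]; simp

lemma integral_sub_sq_gaussianReal (t w : ℝ) (v : ℝ≥0) :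
    ∫ x, (x - w) ^ 2 ∂gaussianReal t v = v + (t - w) ^ 2 := by
  have h1 : Integrable (fun x : ℝ => x) (gaussianReal t v) :=
    (memLp_id_gaussianReal 1).integrable (by simp)
  have h2 : Integrable (fun x : ℝ => (x - t) ^ 2) (gaussianReal t v) :=
    ((memLp_id_gaussianReal 2).sub (memLp_const t)).integrable_sq
  have h3 : Integrable (fun x : ℝ => 2 * (t - w) * x + (w ^ 2 - t ^ 2)) (gaussianReal t v) :=
    (h1.const_mul _).add (integrable_const _)
  have hvar : ∫ x, (x - t) ^ 2 ∂gaussianReal t v = v := by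
    have := variance_fun_id_gaussianReal (μ := t) (v := v)
    rw [variance_eq_integral (by fun_prop)] at this
    simpa [integral_id_gaussianReal] using this
  have : (fun x : ℝ => (x - w) ^ 2) =
      fun x => (x - t) ^ 2 + (2 * (t - w) * x + (w ^ 2 - t ^ 2)) := by
    ext x; ring
  rw [this, integral_add h2 h3,
    integral_add (h1.const_mul _) (integrable_const _), integral_const_mul,
    integral_id_gaussianReal, hvar]
  simp; ring

lemma integrable_sub_sq_gaussianReal (t w : ℝ) (v : ℝ≥0) :
    Integrable (fun x => (x - w) ^ 2) (gaussianReal t v) :=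
  ((memLp_id_gaussianReal 2).sub (memLp_const w)).integrable_sq

lemma integrable_re_sub_sq (m w : ℂ) (v : ℝ≥0) :
    Integrable (fun x : ℂ => (x.re - w.re) ^ 2) (complexGaussian m v) := by
  have := integrable_sub_sq_gaussianReal m.re w.re (v / 2)
  rw [← map_re_complexGaussian] at this
  exact this.comp_measurable (by fun_prop)

lemma integrable_im_sub_sq (m w : ℂ) (v : ℝ≥0) :
    Integrable (fun x : ℂ => (x.im - w.im) ^ 2) (complexGaussian m v) := by
  have := integrable_sub_sq_gaussianReal m.im w.im (v / 2)
  rw [← map_im_complexGaussian] at this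
  exact this.comp_measurable (by fun_prop)

lemma integrable_norm_sub_sq_complexGaussian (m w : ℂ) (v : ℝ≥0) :
    Integrable (fun x => ‖x - w‖ ^ 2) (complexGaussian m v) := by
  simp_rw [norm_sub_sq_eq]
  exact (integrable_re_sub_sq m w v).add (integrable_im_sub_sq m w v)

lemma integral_norm_sub_sq_complexGaussian (m w : ℂ) (v : ℝ≥0) :
    ∫ x, ‖x - w‖ ^ 2 ∂complexGaussian m v = v + ‖m - w‖ ^ 2 := by
  simp_rw [norm_sub_sq_eq]
  rw [integral_add (integrable_re_sub_sq m w v) (integrable_im_sub_sq m w v)]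
  have h1 := integral_sub_sq_gaussianReal m.re w.re (v / 2)
  have h2 := integral_sub_sq_gaussianReal m.im w.im (v / 2)
  rw [← map_re_complexGaussian, integral_map (by fun_prop) (by fun_prop)] at h1
  rw [← map_im_complexGaussian, integral_map (by fun_prop) (by fun_prop)] at h2
  rw [h1, h2]
  push_cast; ring

lemma lintegral_norm_sub_sq_complexGaussian (m w : ℂ) (v : ℝ≥0) :
    ∫⁻ x, ENNReal.ofReal (‖x - w‖ ^ 2) ∂complexGaussian m v =
      ENNReal.ofReal (v + ‖m - w‖ ^ 2) := by
  rw [← integral_norm_sub_sq_complexGaussian, ofReal_integral_eq_lintegral_ofReal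
    (integrable_norm_sub_sq_complexGaussian m w v) (by filter_upwards with x; positivity)]

lemma memLp_two_id_complexGaussian (m : ℂ) (v : ℝ≥0) :
    MemLp (fun x : ℂ => x) 2 (complexGaussian m v) := by
  rw [memLp_two_iff_integrable_sq_norm (by fun_prop)]
  simpa using integrable_norm_sub_sq_complexGaussian m 0 v

lemma integrable_id_complexGaussian (m : ℂ) (v : ℝ≥0) :
    Integrable (fun x : ℂ => x) (complexGaussian m v) :=
  (memLp_two_id_complexGaussian m v).integrable (by simp)

lemma integral_id_complexGaussian (m : ℂ) (v : ℝ≥0) :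
    ∫ x, x ∂complexGaussian m v = m := by
  have hi := integrable_id_complexGaussian m v
  have h1 := integral_id_gaussianReal (μ := m.re) (v := v / 2)
  have h2 := integral_id_gaussianReal (μ := m.im) (v := v / 2)
  rw [← map_re_complexGaussian, integral_map (by fun_prop) (by fun_prop)] at h1
  rw [← map_im_complexGaussian, integral_map (by fun_prop) (by fun_prop)] at h2
  apply Complex.ext
  · exact (Complex.reCLM.integral_comp_comm hi).symm.trans h1
  · exact (Complex.imCLM.integral_comp_comm hi).symm.trans h2

/-! ### Gaussian conjugacy -/

/-- The variance of `aX + Z` for `X ∼ CN(m, v)` and `Z ∼ CN(0, 1)`. -/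
noncomputable def obsVar (v : ℝ≥0) (a : ℝ) : ℝ≥0 := ‖a‖₊ ^ 2 * v + 1

@[simp]
lemma coe_obsVar (v : ℝ≥0) (a : ℝ) : (obsVar v a : ℝ) = a ^ 2 * v + 1 := by
  simp [obsVar]

lemma obsVar_ne_zero (v : ℝ≥0) (a : ℝ) : obsVar v a ≠ 0 := by
  unfold obsVar; positivity

lemma obsVar_pos (v : ℝ≥0) (a : ℝ) : (0 : ℝ) < a ^ 2 * v + 1 := by positivity

/-- The mean of `X ∼ CN(m, v)` given `aX + Z = y`. -/
noncomputable def gaussianPosteriorMean (m : ℂ) (v : ℝ≥0) (a : ℝ) (y : ℂ) : ℂ :=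
  m + ((a * v / (a ^ 2 * v + 1) : ℝ) : ℂ) * (y - (a : ℂ) * m)

@[fun_prop]
lemma continuous_gaussianPosteriorMean (m : ℂ) (v : ℝ≥0) (a : ℝ) :
    Continuous (gaussianPosteriorMean m v a) := by
  unfold gaussianPosteriorMean; fun_prop

/-- Bayes' formula for densities of jointly Gaussian variables. -/
lemma complexGaussianPDF_mul (m : ℂ) {v : ℝ≥0} (hv : v ≠ 0) (a : ℝ) (x y : ℂ) :
    complexGaussianPDF m v x * complexGaussianPDF (a * x) 1 y =
      complexGaussianPDF (a * m) (a ^ 2 * v + 1) y *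
        complexGaussianPDF (gaussianPosteriorMean m v a y) (v / obsVar v a : ℝ≥0) x := by
  have hv' : (0 : ℝ) < v := by positivity
  have hc := obsVar_pos v a
  unfold complexGaussianPDF
  rw [mul_mul_mul_comm, ← Real.exp_add, mul_mul_mul_comm (1 / (Real.pi * (a ^ 2 * v + 1))),
    ← Real.exp_add]
  simp only [norm_sub_sq_eq, gaussianPosteriorMean, NNReal.coe_div, coe_obsVar]
  simp only [Complex.add_re, Complex.add_im, Complex.mul_re, Complex.mul_im, Complex.ofReal_re,
    Complex.ofReal_im, Complex.sub_re, Complex.sub_im, zero_mul, sub_zero, add_zero]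
  congr 1
  · field_simp
  · congr 1
    field_simp
    ring

/-- Bayes' formula for measures rather than densities, so that it also covers `v = 0`, where prior
and posterior are both the Dirac mass at `m` and `complexGaussianPDF_mul` does not apply. -/
lemma withDensity_complexGaussian (m : ℂ) (v : ℝ≥0) (a : ℝ) (y : ℂ) :
    (complexGaussian m v).withDensity
        (fun x => ENNReal.ofReal (complexGaussianPDF (a * x) 1 y)) =
      ENNReal.ofReal (complexGaussianPDF (a * m) (a ^ 2 * v + 1) y) •
        complexGaussian (gaussianPosteriorMean m v a y) (v / obsVar v a) := by
  have hmeas := measurable_ofReal_complexGaussianPDF_mul a y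
  rcases eq_or_ne v 0 with rfl | hv
  · simp only [zero_div, complexGaussian_zero_var]
    refine Measure.ext_of_lintegral _ fun f hf => ?_
    rw [lintegral_withDensity_eq_lintegral_mul _ hmeas hf]
    simp [gaussianPosteriorMean]
  · have hv' : v / obsVar v a ≠ 0 := div_ne_zero hv (obsVar_ne_zero v a)
    rw [complexGaussian_eq_withDensity _ hv, complexGaussian_eq_withDensity _ hv',
      ← withDensity_mul _ (by fun_prop) hmeas, ← withDensity_smul _ (by fun_prop)]
    congr 1
    ext x
    simp only [Pi.mul_apply, Pi.smul_apply, smul_eq_mul]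
    rw [← ENNReal.ofReal_mul (complexGaussianPDF_nonneg _ (by positivity) _),
      ← ENNReal.ofReal_mul (complexGaussianPDF_nonneg _ (by positivity) _),
      complexGaussianPDF_mul m hv]

/-! ### The mixture density and its posterior weight -/

/-- The density of `aX + Z` for a Bernoulli-Gaussian `X` and `Z ∼ CN(0, 1)`. -/
noncomputable def mixturePDF (m : ℂ) (v : ℝ≥0) (γ a : ℝ) (y : ℂ) : ℝ :=
  (1 - γ) * complexGaussianPDF 0 1 y + γ * complexGaussianPDF (a * m) (a ^ 2 * v + 1) y

/-- The posterior probability of the Gaussian component given `aX + Z = y`. -/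
noncomputable def mixtureProb (m : ℂ) (v : ℝ≥0) (γ a : ℝ) (y : ℂ) : ℝ :=
  γ * complexGaussianPDF (a * m) (a ^ 2 * v + 1) y / mixturePDF m v γ a y

/-- The minimum mean square error as a function of the amplitude `a`. -/
noncomputable def amplitudeMmse (m : ℂ) (v : ℝ≥0) (γ a : ℝ) : ℝ :=
  γ * ∫ y, ((1 - mixtureProb m v γ a y) * ‖gaussianPosteriorMean m v a y‖ ^ 2 +
    v / (a ^ 2 * v + 1)) ∂complexGaussian (a * m) (obsVar v a)

/-- The expected log-density of `aX + Z`. -/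
noncomputable def expectedLogPDF (m : ℂ) (v : ℝ≥0) (γ a : ℝ) : ℝ :=
  (1 - γ) * ∫ y, Real.log (mixturePDF m v γ a y) ∂complexGaussian 0 1 +
    γ * ∫ y, Real.log (mixturePDF m v γ a y) ∂complexGaussian (a * m) (obsVar v a)

section Mixture

variable {γ : ℝ} (m : ℂ) (v : ℝ≥0) (a : ℝ) (y : ℂ)

lemma mixturePDF_pos (hγ₀ : 0 < γ) (hγ₁ : γ < 1) : 0 < mixturePDF m v γ a y := by
  have h1 := complexGaussianPDF_pos 0 one_pos y
  have h2 := complexGaussianPDF_pos (a * m) (obsVar_pos v a) y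
  have : 0 < 1 - γ := by linarith
  unfold mixturePDF; positivity

@[fun_prop]
lemma measurable_mixturePDF : Measurable (mixturePDF m v γ a) := by
  unfold mixturePDF; fun_prop

@[fun_prop]
lemma measurable_mixtureProb : Measurable (mixtureProb m v γ a) := by
  unfold mixtureProb; fun_prop

lemma mixtureProb_nonneg (hγ₀ : 0 < γ) (hγ₁ : γ < 1) : 0 ≤ mixtureProb m v γ a y := by
  have h1 := mixturePDF_pos m v a y hγ₀ hγ₁
  have h2 := complexGaussianPDF_pos (a * m) (obsVar_pos v a) y
  unfold mixtureProb; positivity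

lemma mixtureProb_mul (hγ₀ : 0 < γ) (hγ₁ : γ < 1) :
    mixtureProb m v γ a y * mixturePDF m v γ a y =
      γ * complexGaussianPDF (a * m) (a ^ 2 * v + 1) y :=
  div_mul_cancel₀ _ (mixturePDF_pos m v a y hγ₀ hγ₁).ne'

lemma one_sub_mixtureProb_mul (hγ₀ : 0 < γ) (hγ₁ : γ < 1) :
    (1 - mixtureProb m v γ a y) * mixturePDF m v γ a y =
      (1 - γ) * complexGaussianPDF 0 1 y := by
  rw [sub_mul, mixtureProb_mul m v a y hγ₀ hγ₁]
  unfold mixturePDF; ring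

lemma mixtureProb_le_one (hγ₀ : 0 < γ) (hγ₁ : γ < 1) : mixtureProb m v γ a y ≤ 1 := by
  have h1 := mixturePDF_pos m v a y hγ₀ hγ₁
  have h2 := one_sub_mixtureProb_mul m v a y hγ₀ hγ₁
  have h3 := complexGaussianPDF_pos 0 one_pos y
  have h4 : 0 < 1 - γ := by linarith
  have : 0 < (1 - mixtureProb m v γ a y) * mixturePDF m v γ a y := by rw [h2]; positivity
  have := (pos_iff_pos_of_mul_pos this).2 h1
  linarith

lemma complexGaussianPDF_le (t : ℂ) {c : ℝ} (hc : 1 ≤ c) :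
    complexGaussianPDF t c y ≤ 1 / Real.pi := by
  have hc0 : 0 < c := by linarith
  have h1 : Real.exp (-(‖y - t‖ ^ 2 / c)) ≤ 1 := Real.exp_le_one_iff.2 (by
    have : 0 ≤ ‖y - t‖ ^ 2 / c := by positivity
    linarith)
  have h2 : 1 / (Real.pi * c) ≤ 1 / Real.pi := by
    apply one_div_le_one_div_of_le Real.pi_pos
    nlinarith [Real.pi_pos]
  unfold complexGaussianPDF
  calc _ ≤ 1 / (Real.pi * c) * 1 := by gcongr
    _ ≤ _ := by rwa [mul_one]

lemma one_le_obsVar : 1 ≤ a ^ 2 * (v : ℝ) + 1 := by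
  have : 0 ≤ a ^ 2 * (v : ℝ) := by positivity
  linarith

/-- Both components have variance at least 1, so the mixture is at most `1 / π`; dropping the
Gaussian component bounds it below by `(1 - γ) f₀`. A quadratic bound on the logarithm is integrable
against every complex Gaussian. -/
lemma abs_log_mixturePDF_le (hγ₀ : 0 < γ) (hγ₁ : γ < 1) :
    |Real.log (mixturePDF m v γ a y)| ≤ Real.log Real.pi - Real.log (1 - γ) + ‖y‖ ^ 2 := by
  have hg : 0 < 1 - γ := by linarith
  have hpi := Real.pi_pos
  have hpos := mixturePDF_pos m v a y hγ₀ hγ₁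
  have hlog1 : 0 < Real.log Real.pi := Real.log_pos (by linarith [Real.pi_gt_three])
  have hlog2 : Real.log (1 - γ) ≤ 0 := Real.log_nonpos hg.le (by linarith)
  have hup : Real.log (mixturePDF m v γ a y) ≤ - Real.log Real.pi := by
    rw [← Real.log_inv]
    apply Real.log_le_log hpos
    have h1 := complexGaussianPDF_le y 0 le_rfl
    have h2 := complexGaussianPDF_le y (a * m) (one_le_obsVar v a)
    rw [one_div] at h1 h2
    unfold mixturePDF
    nlinarith
  have hlow : Real.log (1 - γ) - Real.log Real.pi - ‖y‖ ^ 2 ≤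
      Real.log (mixturePDF m v γ a y) := by
    have : Real.log (1 - γ) - Real.log Real.pi - ‖y‖ ^ 2 =
        Real.log ((1 - γ) * complexGaussianPDF 0 1 y) := by
      unfold complexGaussianPDF
      rw [Real.log_mul hg.ne' (by positivity), Real.log_mul (by positivity) (by positivity),
        Real.log_exp, one_div, Real.log_inv]
      simp; ring
    rw [this]
    apply Real.log_le_log (mul_pos hg (complexGaussianPDF_pos _ one_pos _))
    have := complexGaussianPDF_pos (a * m) (obsVar_pos v a) y
    unfold mixturePDF
    nlinarith
  rw [abs_le]
  constructor
  · linarith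
  · nlinarith [sq_nonneg ‖y‖]

lemma integrable_log_mixturePDF (hγ₀ : 0 < γ) (hγ₁ : γ < 1) (t : ℂ) (u : ℝ≥0) :
    Integrable (fun y => Real.log (mixturePDF m v γ a y)) (complexGaussian t u) := by
  have hb : Integrable (fun y : ℂ => Real.log Real.pi - Real.log (1 - γ) + ‖y‖ ^ 2)
      (complexGaussian t u) :=
    (integrable_const _).add (by simpa using integrable_norm_sub_sq_complexGaussian t 0 u)
  refine hb.mono' (measurable_mixturePDF m v a).log.aestronglyMeasurable ?_
  filter_upwards with y using abs_log_mixturePDF_le m v a y hγ₀ hγ₁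

end Mixture

/-! ### Pointwise derivatives of the log-density in the amplitude -/

/-- The derivative of a log-sum-exp is the average of the derivatives of the exponents under the
normalized weights. With log-densities as exponents, these weights are `1 - w` and `w`. -/
lemma hasDerivAt_log_add_exp {p q : ℝ} (hp : 0 < p) (hq : 0 < q) {f g : ℝ → ℝ} {f' g' a : ℝ}
    (hf : HasDerivAt f f' a) (hg : HasDerivAt g g' a) :
    HasDerivAt (fun t => Real.log (p * Real.exp (f t) + q * Real.exp (g t)))
      ((1 - q * Real.exp (g a) / (p * Real.exp (f a) + q * Real.exp (g a))) * f' +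
        q * Real.exp (g a) / (p * Real.exp (f a) + q * Real.exp (g a)) * g') a := by
  have hpos : 0 < p * Real.exp (f a) + q * Real.exp (g a) := by positivity
  convert! ((hf.exp.const_mul p).add (hg.exp.const_mul q)).log hpos.ne' using 1
  simp only [Pi.add_apply]
  field_simp
  ring

/-- The real inner product on `ℂ`, in coordinates. -/
def realDot (m z : ℂ) : ℝ := m.re * z.re + m.im * z.im

@[fun_prop]
lemma continuous_realDot (m : ℂ) : Continuous (realDot m) := by
  unfold realDot; fun_prop

lemma abs_realDot_le (m z : ℂ) : |realDot m z| ≤ ‖m‖ ^ 2 + ‖z‖ ^ 2 := by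
  rw [← Complex.normSq_eq_norm_sq, ← Complex.normSq_eq_norm_sq, Complex.normSq_apply,
    Complex.normSq_apply, realDot, abs_le]
  constructor <;>
    nlinarith [sq_nonneg (m.re - z.re), sq_nonneg (m.im - z.im), sq_nonneg (m.re + z.re),
      sq_nonneg (m.im + z.im)]

lemma norm_add_mul_sq (m z : ℂ) (a b : ℝ) :
    ‖(a : ℂ) * m + (b : ℂ) * z‖ ^ 2 =
      a ^ 2 * ‖m‖ ^ 2 + 2 * a * b * realDot m z + b ^ 2 * ‖z‖ ^ 2 := by
  simp only [← Complex.normSq_eq_norm_sq, Complex.normSq_apply, realDot]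
  simp
  ring

lemma norm_sub_mul_sq (m z : ℂ) (a : ℝ) :
    ‖z - (a : ℂ) * m‖ ^ 2 = ‖z‖ ^ 2 - 2 * a * realDot m z + a ^ 2 * ‖m‖ ^ 2 := by
  simp only [← Complex.normSq_eq_norm_sq, Complex.normSq_apply, realDot]
  simp
  ring

/-- The derivative in `a` of the log-density of `CN(a m, a² v + 1)` at `z`. -/
noncomputable def scoreFixed (m : ℂ) (v : ℝ≥0) (a : ℝ) (z : ℂ) : ℝ :=
  -(2 * a * v / (a ^ 2 * v + 1)) +
    ((2 * realDot m z - 2 * a * ‖m‖ ^ 2) / (a ^ 2 * v + 1) +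
      ‖z - (a : ℂ) * m‖ ^ 2 * (2 * a * v) / (a ^ 2 * v + 1) ^ 2)

/-- The derivative in `a` of the log-density of `CN(0, 1)` at `a m + √(a² v + 1) z`. -/
noncomputable def scoreMoving (m : ℂ) (v : ℝ≥0) (a : ℝ) (z : ℂ) : ℝ :=
  -(2 * a * ‖m‖ ^ 2 +
    2 * (Real.sqrt (a ^ 2 * v + 1) + a ^ 2 * v / Real.sqrt (a ^ 2 * v + 1)) * realDot m z +
    2 * a * v * ‖z‖ ^ 2)

@[fun_prop]
lemma continuous_scoreFixed (m : ℂ) (v : ℝ≥0) (a : ℝ) : Continuous (scoreFixed m v a) := by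
  unfold scoreFixed; fun_prop

@[fun_prop]
lemma continuous_scoreMoving (m : ℂ) (v : ℝ≥0) (a : ℝ) : Continuous (scoreMoving m v a) := by
  unfold scoreMoving; fun_prop

/-- The random variable `a m + √(a² v + 1) z`, which is `CN(a m, a² v + 1)` if `z` is
`CN(0, 1)`. -/
noncomputable def gaussianPath (m : ℂ) (v : ℝ≥0) (a : ℝ) (z : ℂ) : ℂ :=
  (a : ℂ) * m + (Real.sqrt (a ^ 2 * v + 1) : ℂ) * z

@[fun_prop]
lemma continuous_gaussianPath (m : ℂ) (v : ℝ≥0) (a : ℝ) : Continuous (gaussianPath m v a) := by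
  unfold gaussianPath; fun_prop

lemma complexGaussian_obsVar_eq_map (m : ℂ) (v : ℝ≥0) (a : ℝ) :
    complexGaussian (a * m) (obsVar v a) = (complexGaussian 0 1).map (gaussianPath m v a) := by
  rw [complexGaussian_eq_map, coe_obsVar]
  rfl

lemma integral_complexGaussian_obsVar (m : ℂ) (v : ℝ≥0) (a : ℝ) {f : ℂ → ℝ} (hf : Measurable f) :
    ∫ y, f y ∂complexGaussian (a * m) (obsVar v a) =
      ∫ z, f (gaussianPath m v a z) ∂complexGaussian 0 1 := by
  rw [complexGaussian_obsVar_eq_map, integral_map (by fun_prop) (by fun_prop)]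

lemma integrable_complexGaussian_obsVar (m : ℂ) (v : ℝ≥0) (a : ℝ) {f : ℂ → ℝ}
    (hf : Measurable f) :
    Integrable f (complexGaussian (a * m) (obsVar v a)) ↔
      Integrable (fun z => f (gaussianPath m v a z)) (complexGaussian 0 1) := by
  rw [complexGaussian_obsVar_eq_map, integrable_map_measure (by fun_prop) (by fun_prop)]
  rfl

/-- The algebraic core of the I-MMSE relation. Along the path the posterior mean is `m + (a v / s)
z` with `s² = a² v + 1`, so both sides are real quadratic forms in `m` and `z` up to a common
constant, and their coefficients agree. -/
lemma scoreFixed_gaussianPath (m : ℂ) (v : ℝ≥0) (a : ℝ) (z : ℂ) :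
    scoreFixed m v a (gaussianPath m v a z) + scoreMoving m v a z =
      -2 * a * ‖gaussianPosteriorMean m v a (gaussianPath m v a z)‖ ^ 2 -
        2 * a * v / (a ^ 2 * v + 1) := by
  have hc := obsVar_pos v a
  set s := Real.sqrt (a ^ 2 * v + 1) with hs
  have hs0 : 0 < s := Real.sqrt_pos.2 hc
  have hs2 : s ^ 2 = a ^ 2 * v + 1 := Real.sq_sqrt hc.le
  have h1 : ‖gaussianPath m v a z - a * m‖ ^ 2 = s ^ 2 * ‖z‖ ^ 2 := by
    unfold gaussianPath
    rw [add_sub_cancel_left, norm_mul, mul_pow, Complex.norm_real, Real.norm_eq_abs, sq_abs]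
  have h2 : realDot m (gaussianPath m v a z) = a * ‖m‖ ^ 2 + s * realDot m z := by
    simp only [gaussianPath, ← Complex.normSq_eq_norm_sq, Complex.normSq_apply, realDot, ← hs]
    simp
    ring
  have h3 : gaussianPosteriorMean m v a (gaussianPath m v a z) =
      ((1 : ℝ) : ℂ) * m + ((a * v / s : ℝ) : ℂ) * z := by
    unfold gaussianPosteriorMean gaussianPath
    rw [add_sub_cancel_left, ← mul_assoc, ← Complex.ofReal_mul, ← hs, ← hs2]
    congr 2
    · simp
    · congr 1; field_simp
  rw [h3, norm_add_mul_sq]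
  unfold scoreFixed scoreMoving
  rw [h1, h2, ← hs, ← hs2]
  field_simp
  linear_combination (-(realDot m z * s) - a * v * ‖z‖ ^ 2) * hs2

section Deriv

variable (m z : ℂ) (v : ℝ≥0) (a : ℝ)

lemma hasDerivAt_obsVar : HasDerivAt (fun t : ℝ => t ^ 2 * (v : ℝ) + 1) (2 * a * v) a := by
  simpa using ((hasDerivAt_pow 2 a).mul_const (v : ℝ)).add_const 1

lemma complexGaussianPDF_eq_exp (t y : ℂ) {c : ℝ} (hc : 0 < c) :
    complexGaussianPDF t c y = 1 / Real.pi * Real.exp (-Real.log c - ‖y - t‖ ^ 2 / c) := by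
  unfold complexGaussianPDF
  rw [sub_eq_add_neg (-Real.log c), Real.exp_add, Real.exp_neg (Real.log c), Real.exp_log hc]
  field_simp

lemma hasDerivAt_logPDF_fixed :
    HasDerivAt (fun t : ℝ => -Real.log (t ^ 2 * v + 1) - ‖z - (t : ℂ) * m‖ ^ 2 / (t ^ 2 * v + 1))
      (scoreFixed m v a z) a := by
  have hc := obsVar_pos v a
  have h1 := hasDerivAt_obsVar v a
  have h2 : HasDerivAt (fun t : ℝ => ‖z - (t : ℂ) * m‖ ^ 2)
      (-(2 * realDot m z) + 2 * a * ‖m‖ ^ 2) a := by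
    simp_rw [norm_sub_mul_sq]
    have := ((((hasDerivAt_id a).const_mul 2).mul_const (realDot m z)).const_sub
      (‖z‖ ^ 2)).add ((hasDerivAt_pow 2 a).mul_const (‖m‖ ^ 2))
    convert! this using 1
    simp
  convert! (h1.log hc.ne').neg.sub (h2.div h1 hc.ne') using 1
  unfold scoreFixed
  field_simp
  ring

lemma hasDerivAt_logPDF_moving :
    HasDerivAt (fun t : ℝ => -‖gaussianPath m v t z‖ ^ 2) (scoreMoving m v a z) a := by
  have hc := obsVar_pos v a
  have h1 := hasDerivAt_obsVar v a
  have h2 := h1.sqrt hc.ne'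
  have : (fun t : ℝ => -‖gaussianPath m v t z‖ ^ 2) = fun t =>
      -(t ^ 2 * ‖m‖ ^ 2 + 2 * (t * Real.sqrt (t ^ 2 * v + 1)) * realDot m z +
        (t ^ 2 * v + 1) * ‖z‖ ^ 2) := by
    ext t
    unfold gaussianPath
    rw [norm_add_mul_sq, Real.sq_sqrt (obsVar_pos v t).le]
    ring
  rw [this]
  convert! ((((hasDerivAt_pow 2 a).mul_const (‖m‖ ^ 2)).add
    ((((hasDerivAt_id a).mul h2).const_mul 2).mul_const (realDot m z))).add
    (h1.mul_const (‖z‖ ^ 2))).neg using 1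
  unfold scoreMoving
  have hs0 : 0 < Real.sqrt (a ^ 2 * v + 1) := Real.sqrt_pos.2 hc
  dsimp
  field_simp

lemma hasDerivAt_log_obsVar (u : ℝ) :
    HasDerivAt (fun t : ℝ => -Real.log (t ^ 2 * v + 1) - u)
      (-(2 * a * v / (a ^ 2 * v + 1))) a :=
  (((hasDerivAt_obsVar v a).log (obsVar_pos v a).ne').neg.sub_const u)

lemma mixturePDF_eq_exp (γ : ℝ) (y : ℂ) :
    mixturePDF m v γ a y = (1 - γ) / Real.pi * Real.exp (-‖y‖ ^ 2) +
      γ / Real.pi * Real.exp (-Real.log (a ^ 2 * v + 1) -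
        ‖y - (a : ℂ) * m‖ ^ 2 / (a ^ 2 * v + 1)) := by
  unfold mixturePDF
  rw [complexGaussianPDF_eq_exp _ _ (obsVar_pos v a), complexGaussianPDF_eq_exp _ _ one_pos]
  simp
  ring

lemma mixtureProb_eq_exp (γ : ℝ) (y : ℂ) :
    mixtureProb m v γ a y = γ / Real.pi * Real.exp (-Real.log (a ^ 2 * v + 1) -
        ‖y - (a : ℂ) * m‖ ^ 2 / (a ^ 2 * v + 1)) /
      ((1 - γ) / Real.pi * Real.exp (-‖y‖ ^ 2) +
      γ / Real.pi * Real.exp (-Real.log (a ^ 2 * v + 1) -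
        ‖y - (a : ℂ) * m‖ ^ 2 / (a ^ 2 * v + 1))) := by
  rw [← mixturePDF_eq_exp, mixtureProb, complexGaussianPDF_eq_exp _ _ (obsVar_pos v a)]
  congr 1
  ring

lemma norm_gaussianPath_sub_sq :
    ‖gaussianPath m v a z - a * m‖ ^ 2 / (a ^ 2 * v + 1) = ‖z‖ ^ 2 := by
  have hc := obsVar_pos v a
  unfold gaussianPath
  rw [add_sub_cancel_left, norm_mul, mul_pow, Complex.norm_real, Real.norm_eq_abs, sq_abs,
    Real.sq_sqrt hc.le]
  field_simp

variable {γ : ℝ}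

/-- At a fixed point only the Gaussian component varies, so its score appears with weight `w` alone.
-/
lemma hasDerivAt_log_mixturePDF_fixed (hγ₀ : 0 < γ) (hγ₁ : γ < 1) :
    HasDerivAt (fun t => Real.log (mixturePDF m v γ t z))
      (mixtureProb m v γ a z * scoreFixed m v a z) a := by
  have hp : 0 < (1 - γ) / Real.pi := div_pos (by linarith) Real.pi_pos
  have hq : 0 < γ / Real.pi := div_pos hγ₀ Real.pi_pos
  have := hasDerivAt_log_add_exp hp hq (hasDerivAt_const a (-‖z‖ ^ 2))
    (hasDerivAt_logPDF_fixed m z v a)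
  simp_rw [mixturePDF_eq_exp, mixtureProb_eq_exp]
  simpa using this

/-- Along the path the exponent of the Gaussian component is constantly `‖z‖²`, so this component
contributes only the derivative of its normalization; the null component contributes `scoreMoving`.
-/
lemma hasDerivAt_log_mixturePDF_moving (hγ₀ : 0 < γ) (hγ₁ : γ < 1) :
    HasDerivAt (fun t => Real.log (mixturePDF m v γ t (gaussianPath m v t z)))
      ((1 - mixtureProb m v γ a (gaussianPath m v a z)) * scoreMoving m v a z +
        mixtureProb m v γ a (gaussianPath m v a z) * (-(2 * a * v / (a ^ 2 * v + 1)))) a := by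
  have hp : 0 < (1 - γ) / Real.pi := div_pos (by linarith) Real.pi_pos
  have hq : 0 < γ / Real.pi := div_pos hγ₀ Real.pi_pos
  have := hasDerivAt_log_add_exp hp hq (hasDerivAt_logPDF_moving m z v a)
    (hasDerivAt_log_obsVar v a (‖z‖ ^ 2))
  simp_rw [mixturePDF_eq_exp, mixtureProb_eq_exp, norm_gaussianPath_sub_sq]
  exact this

end Deriv

/-! ### Differentiation under the integral sign -/

/-- A dominating function, uniform in `|a| ≤ R` and quadratic in `z`. Divisions by `a² v + 1 ≥ 1`
are simply discarded. -/
lemma abs_scoreFixed_le (m z : ℂ) (v : ℝ≥0) {a R : ℝ} (ha : |a| ≤ R) :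
    |scoreFixed m v a z| ≤ 2 * R * v + (2 * (‖m‖ ^ 2 + ‖z‖ ^ 2) + 2 * R * ‖m‖ ^ 2 +
      (2 * ‖z‖ ^ 2 + 2 * R ^ 2 * ‖m‖ ^ 2) * (2 * R * v)) := by
  have hR : 0 ≤ R := (abs_nonneg a).trans ha
  have hc := one_le_obsVar v a
  have hc0 := obsVar_pos v a
  have hav : |2 * a * v| ≤ 2 * R * v := by
    rw [abs_mul, abs_mul, abs_two, abs_of_nonneg v.coe_nonneg]; gcongr
  have hdiv : ∀ x B : ℝ, |x| ≤ B → |x / (a ^ 2 * v + 1)| ≤ B := fun x B h => by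
    rw [abs_div, abs_of_pos hc0]
    exact (div_le_self (abs_nonneg x) hc).trans h
  have hJ := abs_realDot_le m z
  have haN : |2 * a * ‖m‖ ^ 2| ≤ 2 * R * ‖m‖ ^ 2 := by
    rw [abs_mul, abs_mul, abs_two, abs_of_nonneg (sq_nonneg ‖m‖)]; gcongr
  have hsq : ‖z - (a : ℂ) * m‖ ^ 2 ≤ 2 * ‖z‖ ^ 2 + 2 * R ^ 2 * ‖m‖ ^ 2 := by
    have h1 : ‖z - (a : ℂ) * m‖ ≤ ‖z‖ + R * ‖m‖ := by
      refine (norm_sub_le _ _).trans ?_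
      rw [norm_mul, Complex.norm_real, Real.norm_eq_abs]
      gcongr
    have h2 : ‖z - (a : ℂ) * m‖ ^ 2 ≤ (‖z‖ + R * ‖m‖) ^ 2 := by gcongr
    nlinarith [sq_nonneg (‖z‖ - R * ‖m‖)]
  unfold scoreFixed
  refine (abs_add_le _ _).trans (add_le_add ?_ ((abs_add_le _ _).trans (add_le_add ?_ ?_)))
  · rw [abs_neg]; exact hdiv _ _ hav
  · apply hdiv
    refine (abs_sub _ _).trans (add_le_add ?_ haN)
    rw [abs_mul, abs_two]; gcongr
  · rw [sq (a ^ 2 * (v : ℝ) + 1), ← div_div]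
    apply hdiv
    apply hdiv
    rw [abs_mul, abs_of_nonneg (sq_nonneg ‖z - (a : ℂ) * m‖)]
    gcongr

lemma abs_scoreMoving_le (m z : ℂ) (v : ℝ≥0) {a R : ℝ} (ha : |a| ≤ R) :
    |scoreMoving m v a z| ≤ 2 * R * ‖m‖ ^ 2 +
      2 * ((R ^ 2 * v + 1) + R ^ 2 * v) * (‖m‖ ^ 2 + ‖z‖ ^ 2) + 2 * R * v * ‖z‖ ^ 2 := by
  have hR : 0 ≤ R := (abs_nonneg a).trans ha
  have hc := one_le_obsVar v a
  have ha2 : a ^ 2 ≤ R ^ 2 := by rw [← sq_abs a]; gcongr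
  set s := Real.sqrt (a ^ 2 * v + 1) with hs
  have hs1 : 1 ≤ s := by rw [hs]; exact Real.one_le_sqrt.2 hc
  have hs2 : s ≤ R ^ 2 * v + 1 := by
    have h1 : s ^ 2 = a ^ 2 * v + 1 := Real.sq_sqrt (by positivity)
    have h2 : a ^ 2 * (v : ℝ) ≤ R ^ 2 * v := by gcongr
    nlinarith
  have hs3 : a ^ 2 * v / s ≤ R ^ 2 * v :=
    (div_le_self (by positivity) hs1).trans (by gcongr)
  have hs4 : 0 ≤ s + a ^ 2 * v / s := by positivity
  have hJ := abs_realDot_le m z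
  unfold scoreMoving
  rw [abs_neg]
  refine (abs_add_le _ _).trans (add_le_add ((abs_add_le _ _).trans (add_le_add ?_ ?_)) ?_)
  · rw [abs_mul, abs_mul, abs_two, abs_of_nonneg (sq_nonneg ‖m‖)]; gcongr
  · rw [abs_mul, abs_mul, abs_two, ← hs, abs_of_nonneg hs4]; gcongr
  · rw [abs_mul, abs_mul, abs_mul, abs_two, abs_of_nonneg (sq_nonneg ‖z‖),
      abs_of_nonneg v.coe_nonneg]
    gcongr

lemma abs_two_mul_div_obsVar_le (v : ℝ≥0) {a R : ℝ} (ha : |a| ≤ R) :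
    |2 * a * v / (a ^ 2 * v + 1)| ≤ 2 * R * v := by
  rw [abs_div, abs_of_pos (obsVar_pos v a)]
  refine (div_le_self (abs_nonneg _) (one_le_obsVar v a)).trans ?_
  rw [abs_mul, abs_mul, abs_two, abs_of_nonneg v.coe_nonneg]; gcongr

lemma abs_le_of_mem_ball {a b : ℝ} (h : b ∈ Metric.ball a 1) : |b| ≤ |a| + 1 := by
  have h1 : |b - a| < 1 := by simpa [Real.dist_eq] using h
  have h2 := abs_add_le (b - a) a
  rw [sub_add_cancel] at h2
  linarith

lemma integrable_norm_sq_complexGaussian (m : ℂ) (v : ℝ≥0) :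
    Integrable (fun z : ℂ => ‖z‖ ^ 2) (complexGaussian m v) := by
  simpa using integrable_norm_sub_sq_complexGaussian m 0 v

section

variable {γ : ℝ} (m : ℂ) (v : ℝ≥0) (a : ℝ)

/-- Dominated differentiation on the unit ball around `a`, hence with `R = |a| + 1`; the posterior
weight lies in `[0, 1]` and drops out of the bound. -/
lemma hasDerivAt_integral_log_mixturePDF_fixed (hγ₀ : 0 < γ) (hγ₁ : γ < 1) :
    Integrable (fun z => mixtureProb m v γ a z * scoreFixed m v a z) (complexGaussian 0 1) ∧
      HasDerivAt (fun t => ∫ z, Real.log (mixturePDF m v γ t z) ∂complexGaussian 0 1)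
        (∫ z, mixtureProb m v γ a z * scoreFixed m v a z ∂complexGaussian 0 1) a := by
  have hM := integrable_norm_sq_complexGaussian 0 1
  refine hasDerivAt_integral_of_dominated_loc_of_deriv_le (Metric.ball_mem_nhds a one_pos)
    (.of_forall fun t => (measurable_mixturePDF m v t).log.aestronglyMeasurable)
    (integrable_log_mixturePDF m v a hγ₀ hγ₁ 0 1)
    (F' := fun t z => mixtureProb m v γ t z * scoreFixed m v t z) ?_
    (.of_forall fun z t ht => ?_) (bound := fun z => 2 * (|a| + 1) * v +
      (2 * (‖m‖ ^ 2 + ‖z‖ ^ 2) + 2 * (|a| + 1) * ‖m‖ ^ 2 +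
      (2 * ‖z‖ ^ 2 + 2 * (|a| + 1) ^ 2 * ‖m‖ ^ 2) * (2 * (|a| + 1) * v))) ?_
    (.of_forall fun z t _ => hasDerivAt_log_mixturePDF_fixed m z v t hγ₀ hγ₁)
  · exact ((measurable_mixtureProb m v a).mul
      (continuous_scoreFixed m v a).measurable).aestronglyMeasurable
  · rw [norm_mul, Real.norm_eq_abs, Real.norm_eq_abs,
      abs_of_nonneg (mixtureProb_nonneg m v t z hγ₀ hγ₁)]
    refine (mul_le_of_le_one_left (abs_nonneg _) (mixtureProb_le_one m v t z hγ₀ hγ₁)).trans ?_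
    exact abs_scoreFixed_le m z v (abs_le_of_mem_ball ht)
  · fun_prop

lemma hasDerivAt_integral_log_mixturePDF_moving (hγ₀ : 0 < γ) (hγ₁ : γ < 1) :
    Integrable (fun z => (1 - mixtureProb m v γ a (gaussianPath m v a z)) * scoreMoving m v a z +
        mixtureProb m v γ a (gaussianPath m v a z) * (-(2 * a * v / (a ^ 2 * v + 1))))
        (complexGaussian 0 1) ∧
      HasDerivAt (fun t => ∫ z, Real.log (mixturePDF m v γ t (gaussianPath m v t z))
          ∂complexGaussian 0 1)
        (∫ z, ((1 - mixtureProb m v γ a (gaussianPath m v a z)) * scoreMoving m v a z +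
          mixtureProb m v γ a (gaussianPath m v a z) * (-(2 * a * v / (a ^ 2 * v + 1))))
          ∂complexGaussian 0 1) a := by
  have hM := integrable_norm_sq_complexGaussian 0 1
  refine hasDerivAt_integral_of_dominated_loc_of_deriv_le (Metric.ball_mem_nhds a one_pos)
    (.of_forall fun t => (((measurable_mixturePDF m v t).comp
      (continuous_gaussianPath m v t).measurable).log).aestronglyMeasurable)
    ?_
    (F' := fun t z => (1 - mixtureProb m v γ t (gaussianPath m v t z)) * scoreMoving m v t z +
        mixtureProb m v γ t (gaussianPath m v t z) * (-(2 * t * v / (t ^ 2 * v + 1)))) ?_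
    (.of_forall fun z t ht => ?_) (bound := fun z => (2 * (|a| + 1) * ‖m‖ ^ 2 +
      2 * (((|a| + 1) ^ 2 * v + 1) + (|a| + 1) ^ 2 * v) * (‖m‖ ^ 2 + ‖z‖ ^ 2) +
        2 * (|a| + 1) * v * ‖z‖ ^ 2) + 2 * (|a| + 1) * v) ?_
    (.of_forall fun z t _ => hasDerivAt_log_mixturePDF_moving m z v t hγ₀ hγ₁)
  · exact (integrable_complexGaussian_obsVar m v a (measurable_mixturePDF m v a).log).1
      (integrable_log_mixturePDF m v a hγ₀ hγ₁ _ _)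
  · have h1 : Measurable fun z => mixtureProb m v γ a (gaussianPath m v a z) :=
      (measurable_mixtureProb m v a).comp (continuous_gaussianPath m v a).measurable
    exact (((measurable_const.sub h1).mul (continuous_scoreMoving m v a).measurable).add
      (h1.mul_const _)).aestronglyMeasurable
  · have h0 := mixtureProb_nonneg m v t (gaussianPath m v t z) hγ₀ hγ₁
    have h1 := mixtureProb_le_one m v t (gaussianPath m v t z) hγ₀ hγ₁
    refine (abs_add_le _ _).trans (add_le_add ?_ ?_)
    · rw [abs_mul, abs_of_nonneg (sub_nonneg.2 h1)]
      refine (mul_le_of_le_one_left (abs_nonneg _) (by linarith)).trans ?_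
      exact abs_scoreMoving_le m z v (abs_le_of_mem_ball ht)
    · rw [abs_mul, abs_of_nonneg h0, abs_neg]
      refine (mul_le_of_le_one_left (abs_nonneg _) h1).trans ?_
      exact abs_two_mul_div_obsVar_le v (abs_le_of_mem_ball ht)
  · fun_prop

/-- Both `(1 - γ) f₀ w` and `γ f₁ (1 - w)` equal `γ (1 - γ) f₀ f₁ / f`, so a term averaged over the
null component can be averaged over the Gaussian one. Integrability transfers by the same pointwise
identity. -/
lemma integrable_and_integral_mixtureProb_mul_scoreFixed (hγ₀ : 0 < γ) (hγ₁ : γ < 1) :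
    Integrable (fun z => (1 - mixtureProb m v γ a (gaussianPath m v a z)) *
        scoreFixed m v a (gaussianPath m v a z)) (complexGaussian 0 1) ∧
    (1 - γ) * ∫ z, mixtureProb m v γ a z * scoreFixed m v a z ∂complexGaussian 0 1 =
      γ * ∫ z, (1 - mixtureProb m v γ a (gaussianPath m v a z)) *
        scoreFixed m v a (gaussianPath m v a z) ∂complexGaussian 0 1 := by
  have hfix := (hasDerivAt_integral_log_mixturePDF_fixed m v a hγ₀ hγ₁).1
  have hmeas : Measurable fun y => (1 - mixtureProb m v γ a y) * scoreFixed m v a y :=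
    (measurable_const.sub (measurable_mixtureProb m v a)).mul
      (continuous_scoreFixed m v a).measurable
  have hpt : ∀ y, γ * (complexGaussianPDF (a * m) (a ^ 2 * v + 1) y *
      ((1 - mixtureProb m v γ a y) * scoreFixed m v a y)) =
      (1 - γ) * (complexGaussianPDF 0 1 y * (mixtureProb m v γ a y * scoreFixed m v a y)) := by
    intro y
    have h1 := mixtureProb_mul m v a y hγ₀ hγ₁
    have h2 := one_sub_mixtureProb_mul m v a y hγ₀ hγ₁
    linear_combination (-(1 - mixtureProb m v γ a y) * scoreFixed m v a y) * h1 +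
      (mixtureProb m v γ a y * scoreFixed m v a y) * h2
  have hc := obsVar_pos v a
  rw [← integrable_complexGaussian_obsVar m v a hmeas,
    ← integral_complexGaussian_obsVar m v a hmeas,
    complexGaussian_eq_withDensity _ (obsVar_ne_zero v a)]
  rw [complexGaussian_eq_withDensity _ one_ne_zero] at hfix ⊢
  rw [integrable_withDensity_iff_integrable_smul' (by fun_prop) (by simp)] at hfix ⊢
  rw [integral_withDensity_eq_integral_toReal_smul (by fun_prop) (by simp),
    integral_withDensity_eq_integral_toReal_smul (by fun_prop) (by simp)]
  simp only [coe_obsVar, NNReal.coe_one, smul_eq_mul,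
    ENNReal.toReal_ofReal (complexGaussianPDF_nonneg _ hc.le _),
    ENNReal.toReal_ofReal (complexGaussianPDF_nonneg _ zero_le_one _)] at hfix ⊢
  constructor
  · have := (hfix.const_mul (1 - γ)).const_mul γ⁻¹
    refine this.congr (.of_forall fun y => ?_)
    simp only
    rw [← hpt, inv_mul_cancel_left₀ hγ₀.ne']
  · rw [← integral_const_mul, ← integral_const_mul]
    exact integral_congr_ae (.of_forall fun y => (hpt y).symm)

lemma hasDerivAt_expectedLogPDF (hγ₀ : 0 < γ) (hγ₁ : γ < 1) :
    HasDerivAt (expectedLogPDF m v γ) (-(2 * a * amplitudeMmse m v γ a)) a := by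
  obtain ⟨hF, hF'⟩ := integrable_and_integral_mixtureProb_mul_scoreFixed m v a hγ₀ hγ₁
  obtain ⟨hG, hG'⟩ := hasDerivAt_integral_log_mixturePDF_moving m v a hγ₀ hγ₁
  have h := ((hasDerivAt_integral_log_mixturePDF_fixed m v a hγ₀ hγ₁).2.const_mul (1 - γ)).add
    (hG'.const_mul γ)
  have hfun : expectedLogPDF m v γ = (fun t => (1 - γ) * ∫ z, Real.log (mixturePDF m v γ t z)
      ∂complexGaussian 0 1) + fun t => γ * ∫ z, Real.log (mixturePDF m v γ t (gaussianPath m v t z))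
      ∂complexGaussian 0 1 := by
    ext t
    simp only [expectedLogPDF, Pi.add_apply]
    rw [integral_complexGaussian_obsVar m v t (measurable_mixturePDF m v t).log]
  rw [hfun]
  convert! h using 1
  have hmeas : Measurable fun y => (1 - mixtureProb m v γ a y) *
      ‖gaussianPosteriorMean m v a y‖ ^ 2 + v / (a ^ 2 * v + 1) :=
    ((measurable_const.sub (measurable_mixtureProb m v a)).mul
      (by fun_prop)).add_const _
  rw [hF', ← mul_add, ← integral_add hF hG, amplitudeMmse,
    integral_complexGaussian_obsVar m v a hmeas, mul_left_comm, ← mul_neg, ← neg_mul,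
    ← integral_const_mul]
  congr 1
  refine integral_congr_ae (.of_forall fun z => ?_)
  have := scoreFixed_gaussianPath m v a z
  simp only
  -- The normalization term `-2av/c` occurs with weight `1 - w` in the sum of the scores and with
  -- weight `w` in the moving derivative, hence with total weight 1.
  linear_combination (-(1 - mixtureProb m v γ a (gaussianPath m v a z))) * this

/-- Needed both for the fundamental theorem of calculus and for integrability of the MMSE. Over the
fixed measure `CN(0, 1)`, dominated convergence applies with a bound that does not depend on `a`. -/
lemma continuous_amplitudeMmse (hγ₀ : 0 < γ) (hγ₁ : γ < 1) :
    Continuous (amplitudeMmse m v γ) := by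
  have hmeas : ∀ a, Measurable fun y => (1 - mixtureProb m v γ a y) *
      ‖gaussianPosteriorMean m v a y‖ ^ 2 + v / (a ^ 2 * v + 1) := fun a =>
    ((measurable_const.sub (measurable_mixtureProb m v a)).mul
      (by fun_prop)).add_const _
  have hfun : amplitudeMmse m v γ = fun a => γ * ∫ z,
      ((1 - mixtureProb m v γ a (gaussianPath m v a z)) *
        ‖gaussianPosteriorMean m v a (gaussianPath m v a z)‖ ^ 2 + v / (a ^ 2 * v + 1))
        ∂complexGaussian 0 1 := by
    ext a
    rw [amplitudeMmse, integral_complexGaussian_obsVar m v a (hmeas a)]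
  have hM := integrable_norm_sq_complexGaussian 0 1
  rw [hfun]
  refine continuous_const.mul (continuous_of_dominated
    (bound := fun z => (2 * ‖m‖ ^ 2 + 2 * v * ‖z‖ ^ 2) + v) (fun a => ?_)
    (fun a => .of_forall fun z => ?_) (by fun_prop) (.of_forall fun z => ?_))
  · exact ((hmeas a).comp (continuous_gaussianPath m v a).measurable).aestronglyMeasurable
  · have h0 := mixtureProb_nonneg m v a (gaussianPath m v a z) hγ₀ hγ₁
    have h1 := mixtureProb_le_one m v a (gaussianPath m v a z) hγ₀ hγ₁
    have hc := obsVar_pos v a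
    set s := Real.sqrt (a ^ 2 * v + 1) with hs
    have hs0 : 0 < s := Real.sqrt_pos.2 hc
    have hs2 : s ^ 2 = a ^ 2 * v + 1 := Real.sq_sqrt hc.le
    have h3 : gaussianPosteriorMean m v a (gaussianPath m v a z) =
        m + ((a * v / s : ℝ) : ℂ) * z := by
      unfold gaussianPosteriorMean gaussianPath
      rw [add_sub_cancel_left, ← mul_assoc, ← Complex.ofReal_mul, ← hs, ← hs2]
      congr 3
      field_simp
    -- This is `a² v² ≤ v (a² v + 1)`.
    have h4 : (a * v / s) ^ 2 ≤ v := by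
      rw [div_pow, hs2, div_le_iff₀ hc]
      nlinarith [v.coe_nonneg]
    have h5 : ‖gaussianPosteriorMean m v a (gaussianPath m v a z)‖ ^ 2 ≤
        2 * ‖m‖ ^ 2 + 2 * v * ‖z‖ ^ 2 := by
      rw [h3]
      have h6 := norm_add_le m (((a * v / s : ℝ) : ℂ) * z)
      have h7 : ‖((a * v / s : ℝ) : ℂ) * z‖ ^ 2 ≤ v * ‖z‖ ^ 2 := by
        rw [norm_mul, mul_pow, Complex.norm_real, Real.norm_eq_abs, sq_abs]
        gcongr
      have h8 := pow_le_pow_left₀ (norm_nonneg _) h6 2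
      nlinarith [sq_nonneg (‖m‖ - ‖((a * v / s : ℝ) : ℂ) * z‖)]
    have h9 : (v : ℝ) / (a ^ 2 * v + 1) ≤ v := div_le_self v.coe_nonneg (one_le_obsVar v a)
    have h10 : 0 ≤ (v : ℝ) / (a ^ 2 * v + 1) := by positivity
    rw [Real.norm_eq_abs, abs_of_nonneg (by
      have : 0 ≤ 1 - mixtureProb m v γ a (gaussianPath m v a z) := by linarith
      positivity)]
    refine add_le_add ?_ h9
    exact (mul_le_of_le_one_left (by positivity) (by linarith)).trans h5
  · have hne : ∀ a : ℝ, a ^ 2 * (v : ℝ) + 1 ≠ 0 := fun a => (obsVar_pos v a).ne'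
    have hpath : Continuous fun a => gaussianPath m v a z := by
      unfold gaussianPath; fun_prop
    have hpdf : Continuous fun a : ℝ =>
        complexGaussianPDF (a * m) (a ^ 2 * v + 1) (gaussianPath m v a z) := by
      unfold complexGaussianPDF
      have : ∀ a : ℝ, Real.pi * (a ^ 2 * (v : ℝ) + 1) ≠ 0 := fun a =>
        mul_ne_zero Real.pi_ne_zero (hne a)
      fun_prop (disch := assumption)
    have hpdf0 : Continuous fun a : ℝ => complexGaussianPDF 0 1 (gaussianPath m v a z) := by
      unfold complexGaussianPDF; fun_prop
    have hmix : Continuous fun a : ℝ => mixturePDF m v γ a (gaussianPath m v a z) := by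
      unfold mixturePDF; fun_prop
    have hprob : Continuous fun a : ℝ => mixtureProb m v γ a (gaussianPath m v a z) :=
      (continuous_const.mul hpdf).div hmix fun a => (mixturePDF_pos m v a _ hγ₀ hγ₁).ne'
    have hmean : Continuous fun a : ℝ =>
        gaussianPosteriorMean m v a (gaussianPath m v a z) := by
      unfold gaussianPosteriorMean
      fun_prop (disch := assumption)
    fun_prop (disch := assumption)

/-! ### Integrating the derivative -/

/-- At zero amplitude both components are `CN(0, 1)`, so the value is minus the differential entropy
of the noise. -/
lemma expectedLogPDF_zero :
    expectedLogPDF m v γ 0 = -Real.log Real.pi - 1 := by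
  have h : ∀ y, Real.log (mixturePDF m v γ 0 y) = -Real.log Real.pi - ‖y - 0‖ ^ 2 := by
    intro y
    have : mixturePDF m v γ 0 y = complexGaussianPDF 0 1 y := by
      simp [mixturePDF]; ring
    rw [this]
    unfold complexGaussianPDF
    rw [Real.log_mul (by positivity) (by positivity), Real.log_exp, mul_one, div_one, one_div,
      Real.log_inv]
    ring
  have h1 : obsVar v 0 = 1 := by ext; simp
  have h2 : ∫ y : ℂ, (-Real.log Real.pi - ‖y - 0‖ ^ 2) ∂complexGaussian 0 1 =
      -Real.log Real.pi - 1 := by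
    rw [integral_sub (integrable_const _) (integrable_norm_sub_sq_complexGaussian 0 0 1),
      integral_norm_sub_sq_complexGaussian]
    simp
  simp only [expectedLogPDF, h1, h, Complex.ofReal_zero, zero_mul, h2]
  ring

/-- The integrated form of the I-MMSE relation for Bernoulli-Gaussian input. -/
lemma integral_amplitudeMmse_sqrt (hγ₀ : 0 < γ) (hγ₁ : γ < 1) {s : ℝ} (hs : 0 ≤ s) :
    ∫ t in (0 : ℝ)..s, amplitudeMmse m v γ (Real.sqrt t) =
      expectedLogPDF m v γ 0 - expectedLogPDF m v γ (Real.sqrt s) := by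
  have hcont := continuous_amplitudeMmse m v hγ₀ hγ₁
  have h1 := intervalIntegral.integral_eq_sub_of_hasDerivAt
    (f := expectedLogPDF m v γ) (a := 0) (b := Real.sqrt s)
    (fun a _ => hasDerivAt_expectedLogPDF m v a hγ₀ hγ₁)
    (Continuous.intervalIntegrable (by fun_prop) _ _)
  -- The substitution is read as `t = a²`, with derivative `2a`; this avoids differentiating the
  -- square root, which fails at 0.
  have h2 := intervalIntegral.integral_comp_mul_deriv (a := 0) (b := Real.sqrt s)
    (f := fun a => a ^ 2) (f' := fun a => 2 * a)
    (g := fun t => amplitudeMmse m v γ (Real.sqrt t))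
    (fun a _ => by simpa using hasDerivAt_pow 2 a) (by fun_prop)
    (hcont.comp Real.continuous_sqrt)
  rw [Real.sq_sqrt hs, zero_pow two_ne_zero] at h2
  rw [← h2, ← neg_sub, ← h1, ← intervalIntegral.integral_neg]
  refine intervalIntegral.integral_congr fun a ha => ?_
  rw [Set.uIcc_of_le (Real.sqrt_nonneg s)] at ha
  simp only [Function.comp_apply, Real.sqrt_sq ha.1]
  ring

end

/-! ### The posterior law and its first two moments -/

/-- The unnormalized posterior law of a Bernoulli-Gaussian `X` given `aX + Z = y`. -/
noncomputable def posteriorMeasure (m : ℂ) (v : ℝ≥0) (γ a : ℝ) (y : ℂ) : Measure ℂ :=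
  ENNReal.ofReal ((1 - γ) * complexGaussianPDF 0 1 y) • Measure.dirac 0 +
    ENNReal.ofReal (γ * complexGaussianPDF (a * m) (a ^ 2 * v + 1) y) •
      complexGaussian (gaussianPosteriorMean m v a y) (v / obsVar v a)

section

variable {γ : ℝ} (m : ℂ) (v : ℝ≥0) (a : ℝ)

lemma withDensity_bernoulliGaussian (hγ₀ : 0 < γ) (hγ₁ : γ < 1) (y : ℂ) :
    (bernoulliGaussian m v γ).withDensity
        (fun x => ENNReal.ofReal (complexGaussianPDF (a * x) 1 y)) =
      posteriorMeasure m v γ a y := by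
  have hmeas := measurable_ofReal_complexGaussianPDF_mul a y
  have hdirac : (Measure.dirac (0 : ℂ)).withDensity
      (fun x => ENNReal.ofReal (complexGaussianPDF (a * x) 1 y)) =
      ENNReal.ofReal (complexGaussianPDF 0 1 y) • Measure.dirac 0 := by
    refine Measure.ext_of_lintegral _ fun f hf => ?_
    rw [lintegral_withDensity_eq_lintegral_mul _ hmeas hf]
    simp
  unfold bernoulliGaussian posteriorMeasure
  rw [withDensity_add_measure, withDensity_smul_measure, withDensity_smul_measure, hdirac,
    withDensity_complexGaussian, smul_smul, smul_smul, ← ENNReal.ofReal_mul (by linarith),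
    ← ENNReal.ofReal_mul hγ₀.le]

instance (m : ℂ) (v : ℝ≥0) (γ a : ℝ) (y : ℂ) : IsFiniteMeasure (posteriorMeasure m v γ a y) := by
  have := Measure.smul_finite (Measure.dirac (0 : ℂ))
    (ENNReal.ofReal_ne_top (r := (1 - γ) * complexGaussianPDF 0 1 y))
  have := Measure.smul_finite
    (complexGaussian (gaussianPosteriorMean m v a y) (v / obsVar v a))
    (ENNReal.ofReal_ne_top (r := γ * complexGaussianPDF (a * m) (a ^ 2 * v + 1) y))
  unfold posteriorMeasure
  infer_instance

lemma posteriorMeasure_univ (hγ₀ : 0 < γ) (hγ₁ : γ < 1) (y : ℂ) :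
    posteriorMeasure m v γ a y Set.univ = ENNReal.ofReal (mixturePDF m v γ a y) := by
  have h1 := complexGaussianPDF_pos 0 one_pos y
  have h2 := complexGaussianPDF_pos (a * m) (obsVar_pos v a) y
  have h3 : 0 < 1 - γ := by linarith
  unfold posteriorMeasure mixturePDF
  rw [ENNReal.ofReal_add (by positivity) (by positivity)]
  simp

lemma integral_id_posteriorMeasure (hγ₀ : 0 < γ) (hγ₁ : γ < 1) (y : ℂ) :
    ∫ x, x ∂posteriorMeasure m v γ a y =
      mixturePDF m v γ a y • ((mixtureProb m v γ a y : ℂ) * gaussianPosteriorMean m v a y) := by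
  have h2 := complexGaussianPDF_pos (a * m) (obsVar_pos v a) y
  have h3 := mixtureProb_mul m v a y hγ₀ hγ₁
  unfold posteriorMeasure
  rw [integral_add_measure ((integrable_dirac (by simp)).smul_measure ENNReal.ofReal_ne_top)
    ((integrable_id_complexGaussian _ _).smul_measure ENNReal.ofReal_ne_top),
    integral_smul_measure, integral_smul_measure, integral_dirac, integral_id_complexGaussian,
    smul_zero, zero_add, ENNReal.toReal_ofReal (by positivity), ← h3]
  simp
  ring

/-- Around `w μ`, the atom contributes `w²|μ|²` with mass `(1 - w) f`, and the Gaussian contributes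
`v/c + (1 - w)²|μ|²` with mass `w f = γ f₁`. The cross weights combine through `w²(1 - w) + w(1 -
w)² = w(1 - w)`. -/
lemma lintegral_norm_sub_sq_posteriorMeasure (hγ₀ : 0 < γ) (hγ₁ : γ < 1) (y : ℂ) :
    ∫⁻ x, ENNReal.ofReal (‖x - (mixtureProb m v γ a y : ℂ) * gaussianPosteriorMean m v a y‖ ^ 2)
        ∂posteriorMeasure m v γ a y =
      ENNReal.ofReal (γ * (complexGaussianPDF (a * m) (a ^ 2 * v + 1) y *
        ((1 - mixtureProb m v γ a y) * ‖gaussianPosteriorMean m v a y‖ ^ 2 +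
          v / (a ^ 2 * v + 1)))) := by
  have h0 := complexGaussianPDF_pos 0 one_pos y
  have h2 := complexGaussianPDF_pos (a * m) (obsVar_pos v a) y
  have h3 := mixtureProb_mul m v a y hγ₀ hγ₁
  have h4 := one_sub_mixtureProb_mul m v a y hγ₀ hγ₁
  have h5 : 0 < 1 - γ := by linarith
  set w := mixtureProb m v γ a y
  set μ := gaussianPosteriorMean m v a y
  have h6 : ‖(0 : ℂ) - (w : ℂ) * μ‖ ^ 2 = w ^ 2 * ‖μ‖ ^ 2 := by
    rw [zero_sub, norm_neg, norm_mul, mul_pow, Complex.norm_real, Real.norm_eq_abs, sq_abs]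
  have h7 : ‖μ - (w : ℂ) * μ‖ ^ 2 = (1 - w) ^ 2 * ‖μ‖ ^ 2 := by
    have : μ - (w : ℂ) * μ = ((1 - w : ℝ) : ℂ) * μ := by push_cast; ring
    rw [this, norm_mul, mul_pow, Complex.norm_real, Real.norm_eq_abs, sq_abs]
  unfold posteriorMeasure
  rw [lintegral_add_measure, lintegral_smul_measure, lintegral_smul_measure, lintegral_dirac,
    lintegral_norm_sub_sq_complexGaussian, h6, h7, smul_eq_mul, smul_eq_mul,
    ← ENNReal.ofReal_mul (by positivity), ← ENNReal.ofReal_mul (by positivity),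
    ← ENNReal.ofReal_add (by positivity) (by positivity)]
  congr 1
  rw [NNReal.coe_div, coe_obsVar]
  linear_combination (-(w ^ 2 * ‖μ‖ ^ 2)) * h4 + (w * (1 - w) * ‖μ‖ ^ 2) * h3

lemma withDensity_mixturePDF (hγ₀ : 0 < γ) (hγ₁ : γ < 1) :
    volume.withDensity (fun y => ENNReal.ofReal (mixturePDF m v γ a y)) =
      ENNReal.ofReal (1 - γ) • complexGaussian 0 1 +
        ENNReal.ofReal γ • complexGaussian (a * m) (obsVar v a) := by
  have h5 : 0 < 1 - γ := by linarith
  rw [complexGaussian_eq_withDensity _ one_ne_zero,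
    complexGaussian_eq_withDensity _ (obsVar_ne_zero v a), ← withDensity_smul _ (by fun_prop),
    ← withDensity_smul _ (by fun_prop), ← withDensity_add_left (by fun_prop)]
  congr 1
  ext y
  have h1 := complexGaussianPDF_pos 0 one_pos y
  have h2 := complexGaussianPDF_pos (a * m) (obsVar_pos v a) y
  simp only [Pi.add_apply, Pi.smul_apply, smul_eq_mul, coe_obsVar, NNReal.coe_one]
  rw [← ENNReal.ofReal_mul h5.le, ← ENNReal.ofReal_mul hγ₀.le,
    ← ENNReal.ofReal_add (by positivity) (by positivity)]
  rfl

lemma integrable_and_integral_log_mixturePDF (hγ₀ : 0 < γ) (hγ₁ : γ < 1) :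
    Integrable (fun y => Real.log (mixturePDF m v γ a y))
        (volume.withDensity (fun y => ENNReal.ofReal (mixturePDF m v γ a y))) ∧
      ∫ y, Real.log (mixturePDF m v γ a y)
        ∂volume.withDensity (fun y => ENNReal.ofReal (mixturePDF m v γ a y)) =
      expectedLogPDF m v γ a := by
  have h1 := (integrable_log_mixturePDF m v a hγ₀ hγ₁ 0 1).smul_measure
    (ENNReal.ofReal_ne_top (r := 1 - γ))
  have h2 := (integrable_log_mixturePDF m v a hγ₀ hγ₁ (a * m) (obsVar v a)).smul_measure
    (ENNReal.ofReal_ne_top (r := γ))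
  rw [withDensity_mixturePDF m v a hγ₀ hγ₁]
  refine ⟨h1.add_measure h2, ?_⟩
  rw [integral_add_measure h1 h2, integral_smul_measure, integral_smul_measure,
    ENNReal.toReal_ofReal (by linarith), ENNReal.toReal_ofReal hγ₀.le]
  rfl

lemma amplitudeMmse_eq_integral :
    amplitudeMmse m v γ a = ∫ y, γ * (complexGaussianPDF (a * m) (a ^ 2 * v + 1) y *
        ((1 - mixtureProb m v γ a y) * ‖gaussianPosteriorMean m v a y‖ ^ 2 +
          v / (a ^ 2 * v + 1))) := by
  rw [amplitudeMmse, complexGaussian_eq_withDensity _ (obsVar_ne_zero v a),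
    integral_withDensity_eq_integral_toReal_smul (by fun_prop) (by simp), ← integral_const_mul]
  simp only [coe_obsVar, smul_eq_mul,
    ENNReal.toReal_ofReal (complexGaussianPDF_nonneg _ (obsVar_pos v a).le _)]

lemma integrable_id_bernoulliGaussian (γ : ℝ) :
    Integrable (fun x : ℂ => x) (bernoulliGaussian m v γ) :=
  ((integrable_dirac (by simp)).smul_measure ENNReal.ofReal_ne_top).add_measure
    ((integrable_id_complexGaussian _ _).smul_measure ENNReal.ofReal_ne_top)

/-- Dividing numerator and denominator of `γ f₁ / f` by `γ f₁` gives the stated posterior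
probability. The integrands then differ only by the factorization `w f = γ f₁`. -/
lemma bgMmseIntegral_eq (hγ₀ : 0 < γ) (hγ₁ : γ < 1) {s : ℝ} (hs : 0 ≤ s) :
    bgMmseIntegral m v γ s = amplitudeMmse m v γ (Real.sqrt s) := by
  have hs2 : Real.sqrt s ^ 2 = s := Real.sq_sqrt hs
  have hmean : ∀ y, bgPosteriorMean m v s y = gaussianPosteriorMean m v (Real.sqrt s) y := by
    intro y
    rw [bgPosteriorMean, gaussianPosteriorMean, hs2, add_comm 1 (s * (v : ℝ))]
  have hpdf : ∀ y, bgObservationPDF m v γ s y = mixturePDF m v γ (Real.sqrt s) y := by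
    intro y
    simp [bgObservationPDF, mixturePDF, complexGaussianPDF, hs2]
  have hprob : ∀ y, bgPosteriorProb m v γ s y = mixtureProb m v γ (Real.sqrt s) y := by
    intro y
    have hc : 0 < s * (v : ℝ) + 1 := by positivity
    have hg : 0 < 1 - γ := by linarith
    have hpos : 0 < 1 + (1 - γ) / γ * (s * v + 1) *
        Real.exp (-‖y‖ ^ 2 + ‖y - (Real.sqrt s : ℂ) * m‖ ^ 2 / (s * v + 1)) := by positivity
    have hmix := mixturePDF_pos m v (Real.sqrt s) y hγ₀ hγ₁
    rw [mixtureProb, eq_div_iff hmix.ne', bgPosteriorProb, inv_mul_eq_iff_eq_mul₀ hpos.ne',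
      mixturePDF, complexGaussianPDF, complexGaussianPDF, hs2, Real.exp_add, Real.exp_neg
      (‖y - (Real.sqrt s : ℂ) * m‖ ^ 2 / (s * v + 1))]
    simp only [sub_zero, mul_one, div_one]
    field_simp
    ring
  rw [amplitudeMmse_eq_integral, bgMmseIntegral]
  refine integral_congr_ae (.of_forall fun y => ?_)
  have h3 := mixtureProb_mul m v (Real.sqrt s) y hγ₀ hγ₁
  simp only [hmean, hpdf, hprob]
  rw [hs2] at h3 ⊢
  rw [add_comm 1 (s * (v : ℝ))]
  linear_combination ((1 - mixtureProb m v γ (Real.sqrt s) y) *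
    ‖gaussianPosteriorMean m v (Real.sqrt s) y‖ ^ 2 + v / (s * v + 1)) * h3

end

/-! ### The channel: joint law, conditional mean, information -/

section Channel

variable {Ω : Type*} [MeasurableSpace Ω] {P : Measure Ω} [IsProbabilityMeasure P] {X Z : Ω → ℂ}

/-- By independence, for fixed `x` the output is the noise translated by `a x`; translation
invariance of Lebesgue measure gives the kernel density. -/
lemma map_prodMk_add_eq_withDensity (hX : Measurable X) (hZ : Measurable Z)
    (hXZ : IndepFun X Z P) (hZlaw : P.map Z = complexGaussian 0 1) (a : ℝ) :
    P.map (fun ω => (X ω, (a : ℂ) * X ω + Z ω)) = ((P.map X).prod volume).withDensity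
      (fun p => ENNReal.ofReal (complexGaussianPDF (a * p.1) 1 p.2)) := by
  have := Measure.isProbabilityMeasure_map (μ := P) hX.aemeasurable
  have hk := (measurable_uncurry_complexGaussianPDF a).ennreal_ofReal
  have hprod := (indepFun_iff_map_prod_eq_prod_map_map hX.aemeasurable hZ.aemeasurable).1 hXZ
  have hmap : P.map (fun ω => (X ω, (a : ℂ) * X ω + Z ω)) =
      (P.map fun ω => (X ω, Z ω)).map fun p => (p.1, (a : ℂ) * p.1 + p.2) := by
    rw [Measure.map_map (by fun_prop) (by fun_prop)]; rfl
  rw [hmap, hprod, hZlaw, complexGaussian_eq_withDensity _ one_ne_zero]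
  refine Measure.ext_of_lintegral _ fun f hf => ?_
  have hf' : Measurable fun p : ℂ × ℂ => f (p.1, (a : ℂ) * p.1 + p.2) := by fun_prop
  rw [lintegral_map hf (by fun_prop), lintegral_withDensity_eq_lintegral_mul _ hk hf,
    lintegral_prod _ hf'.aemeasurable, lintegral_prod _ (hk.mul hf).aemeasurable]
  refine lintegral_congr fun x => ?_
  rw [lintegral_withDensity_eq_lintegral_mul _ (by fun_prop) (by fun_prop),
    ← lintegral_add_left_eq_self (fun y => ((fun p : ℂ × ℂ =>
      ENNReal.ofReal (complexGaussianPDF (a * p.1) 1 p.2)) * f) (x, y)) ((a : ℂ) * x)]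
  refine lintegral_congr fun z => ?_
  simp [complexGaussianPDF]

variable {m : ℂ} {v : ℝ≥0} {γ : ℝ}

/-- Disintegration along the output: Tonelli puts the integral over `x` inside, and Bayes' formula
identifies the inner measure. -/
lemma lintegral_joint (hX : Measurable X) (hZ : Measurable Z)
    (hXZ : IndepFun X Z P) (hZlaw : P.map Z = complexGaussian 0 1)
    (hXlaw : P.map X = bernoulliGaussian m v γ) (hγ₀ : 0 < γ) (hγ₁ : γ < 1) (a : ℝ)
    {g : ℂ × ℂ → ℝ≥0∞} (hg : Measurable g) :
    ∫⁻ ω, g (X ω, (a : ℂ) * X ω + Z ω) ∂P =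
      ∫⁻ y, ∫⁻ x, g (x, y) ∂posteriorMeasure m v γ a y := by
  have := Measure.isProbabilityMeasure_map (μ := P) hX.aemeasurable
  have hk := (measurable_uncurry_complexGaussianPDF a).ennreal_ofReal
  rw [← lintegral_map (f := g) (g := fun ω => (X ω, (a : ℂ) * X ω + Z ω)) hg (by fun_prop),
    map_prodMk_add_eq_withDensity hX hZ hXZ hZlaw,
    lintegral_withDensity_eq_lintegral_mul _ hk hg,
    lintegral_prod_symm _ (hk.mul hg).aemeasurable]
  refine lintegral_congr fun y => ?_
  rw [← withDensity_bernoulliGaussian m v a hγ₀ hγ₁ y, hXlaw,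
    lintegral_withDensity_eq_lintegral_mul _ (measurable_ofReal_complexGaussianPDF_mul a y)
      (by fun_prop)]
  rfl

lemma integral_joint (hX : Measurable X) (hZ : Measurable Z)
    (hXZ : IndepFun X Z P) (hZlaw : P.map Z = complexGaussian 0 1)
    (hXlaw : P.map X = bernoulliGaussian m v γ) (hγ₀ : 0 < γ) (hγ₁ : γ < 1) (a : ℝ)
    {g : ℂ × ℂ → ℂ} (hg : Measurable g)
    (hint : Integrable (fun ω => g (X ω, (a : ℂ) * X ω + Z ω)) P) :
    ∫ ω, g (X ω, (a : ℂ) * X ω + Z ω) ∂P =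
      ∫ y, ∫ x, g (x, y) ∂posteriorMeasure m v γ a y := by
  have := Measure.isProbabilityMeasure_map (μ := P) hX.aemeasurable
  have hk := (measurable_uncurry_complexGaussianPDF a).ennreal_ofReal
  have hint' := (integrable_map_measure (g := g) (f := fun ω => (X ω, (a : ℂ) * X ω + Z ω))
    (μ := P) hg.aestronglyMeasurable (by fun_prop)).2 hint
  rw [← integral_map (f := g) (φ := fun ω => (X ω, (a : ℂ) * X ω + Z ω)) (by fun_prop)
    hg.aestronglyMeasurable]
  rw [map_prodMk_add_eq_withDensity hX hZ hXZ hZlaw] at hint' ⊢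
  rw [integrable_withDensity_iff_integrable_smul' hk (by simp)] at hint'
  rw [integral_withDensity_eq_integral_toReal_smul hk (by simp), integral_prod_symm _ hint']
  refine integral_congr_ae (.of_forall fun y => ?_)
  simp only
  rw [← withDensity_bernoulliGaussian m v a hγ₀ hγ₁ y, hXlaw,
    integral_withDensity_eq_integral_toReal_smul (measurable_ofReal_complexGaussianPDF_mul a y)
      (by simp)]

lemma map_observation (hX : Measurable X) (hZ : Measurable Z)
    (hXZ : IndepFun X Z P) (hZlaw : P.map Z = complexGaussian 0 1)
    (hXlaw : P.map X = bernoulliGaussian m v γ) (hγ₀ : 0 < γ) (hγ₁ : γ < 1) (a : ℝ) :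
    P.map (fun ω => (a : ℂ) * X ω + Z ω) =
      volume.withDensity (fun y => ENNReal.ofReal (mixturePDF m v γ a y)) := by
  refine Measure.ext_of_lintegral _ fun f hf => ?_
  rw [lintegral_map hf (by fun_prop),
    lintegral_joint hX hZ hXZ hZlaw hXlaw hγ₀ hγ₁ a (g := fun p => f p.2) (by fun_prop),
    lintegral_withDensity_eq_lintegral_mul _ (by fun_prop) hf]
  refine lintegral_congr fun y => ?_
  simp [posteriorMeasure_univ m v a hγ₀ hγ₁, mul_comm]

/-- The conditional expectation is characterized by integrals over the events `Y ∈ T`.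
Disintegration turns these into integrals over `T` of the unnormalized posterior mean, which is `f`
times the normalized one. -/
lemma condExp_bernoulliGaussian (hX : Measurable X) (hZ : Measurable Z)
    (hXZ : IndepFun X Z P) (hZlaw : P.map Z = complexGaussian 0 1)
    (hXlaw : P.map X = bernoulliGaussian m v γ) (hγ₀ : 0 < γ) (hγ₁ : γ < 1) (a : ℝ) :
    (fun ω => (mixtureProb m v γ a ((a : ℂ) * X ω + Z ω) : ℂ) *
        gaussianPosteriorMean m v a ((a : ℂ) * X ω + Z ω)) =ᵐ[P]
      P[X | MeasurableSpace.comap (fun ω => (a : ℂ) * X ω + Z ω) inferInstance] := by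
  have hXint : Integrable X P := by
    have := integrable_id_bernoulliGaussian m v γ
    rw [← hXlaw] at this
    exact this.comp_measurable hX
  have hZint : Integrable Z P := by
    have := integrable_id_complexGaussian 0 1
    rw [← hZlaw] at this
    exact this.comp_measurable hZ
  have hY : Measurable fun ω => (a : ℂ) * X ω + Z ω := by fun_prop
  have hYint : Integrable (fun ω => (a : ℂ) * X ω + Z ω) P := (hXint.const_mul _).add hZint
  have hgm : Measurable fun y =>
      (mixtureProb m v γ a y : ℂ) * gaussianPosteriorMean m v a y := by fun_prop
  have hmean : Integrable (fun ω => gaussianPosteriorMean m v a ((a : ℂ) * X ω + Z ω)) P :=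
    (integrable_const _).add ((hYint.sub (integrable_const _)).const_mul _)
  have hgint : Integrable (fun ω => (mixtureProb m v γ a ((a : ℂ) * X ω + Z ω) : ℂ) *
      gaussianPosteriorMean m v a ((a : ℂ) * X ω + Z ω)) P := by
    refine hmean.mono (hgm.comp hY).aestronglyMeasurable (.of_forall fun ω => ?_)
    rw [norm_mul, Complex.norm_real, Real.norm_eq_abs,
      abs_of_nonneg (mixtureProb_nonneg m v a _ hγ₀ hγ₁)]
    exact mul_le_of_le_one_left (norm_nonneg _) (mixtureProb_le_one m v a _ hγ₀ hγ₁)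
  refine ae_eq_condExp_of_forall_setIntegral_eq hY.comap_le hXint
    (fun _ _ _ => hgint.integrableOn) ?_ ?_
  · rintro _ ⟨T, hT, rfl⟩ -
    have h1 : ∫ ω in (fun ω => (a : ℂ) * X ω + Z ω) ⁻¹' T, X ω ∂P =
        ∫ y, T.indicator (fun y => mixturePDF m v γ a y •
          ((mixtureProb m v γ a y : ℂ) * gaussianPosteriorMean m v a y)) y := by
      rw [← integral_indicator (hY hT)]
      have := integral_joint hX hZ hXZ hZlaw hXlaw hγ₀ hγ₁ a
        (g := (Prod.snd ⁻¹' T).indicator Prod.fst)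
        (measurable_fst.indicator (measurable_snd hT)) (hXint.indicator (hY hT))
      refine this.trans (integral_congr_ae (.of_forall fun y => ?_))
      by_cases hy : y ∈ T
      · simp [Set.indicator, hy, ← integral_id_posteriorMeasure m v a hγ₀ hγ₁]
      · simp [Set.indicator, hy]
    rw [h1, ← setIntegral_map (μ := P) (f := fun y =>
      (mixtureProb m v γ a y : ℂ) * gaussianPosteriorMean m v a y) hT
      hgm.aestronglyMeasurable hY.aemeasurable,
      map_observation hX hZ hXZ hZlaw hXlaw hγ₀ hγ₁ a, ← integral_indicator hT,
      integral_withDensity_eq_integral_toReal_smul (by fun_prop) (by simp)]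
    refine integral_congr_ae (.of_forall fun y => ?_)
    by_cases hy : y ∈ T
    · simp [Set.indicator, hy, ENNReal.toReal_ofReal (mixturePDF_pos m v a y hγ₀ hγ₁).le]
    · simp [Set.indicator, hy]
  · exact (hgm.comp (comap_measurable _)).aestronglyMeasurable

/-- Both sides are integrals of nonnegative functions, so the comparison is made between lower
integrals and no integrability of the squared error has to be shown. -/
lemma mmse_eq_amplitudeMmse (hX : Measurable X) (hZ : Measurable Z)
    (hXZ : IndepFun X Z P) (hZlaw : P.map Z = complexGaussian 0 1)
    (hXlaw : P.map X = bernoulliGaussian m v γ) (hγ₀ : 0 < γ) (hγ₁ : γ < 1) (a : ℝ) :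
    mmse P X (fun ω => (a : ℂ) * X ω + Z ω) = amplitudeMmse m v γ a := by
  have hgm : Measurable fun y =>
      (mixtureProb m v γ a y : ℂ) * gaussianPosteriorMean m v a y := by fun_prop
  have hcond := condExp_bernoulliGaussian hX hZ hXZ hZlaw hXlaw hγ₀ hγ₁ a
  have h1 : mmse P X (fun ω => (a : ℂ) * X ω + Z ω) =
      ∫ ω, ‖X ω - (mixtureProb m v γ a ((a : ℂ) * X ω + Z ω) : ℂ) *
        gaussianPosteriorMean m v a ((a : ℂ) * X ω + Z ω)‖ ^ 2 ∂P := by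
    refine integral_congr_ae ?_
    filter_upwards [hcond] with ω hω
    rw [hω]
  have hm : Measurable fun p : ℂ × ℂ => ‖p.1 - (mixtureProb m v γ a p.2 : ℂ) *
      gaussianPosteriorMean m v a p.2‖ ^ 2 :=
    ((measurable_fst.sub (hgm.comp measurable_snd)).norm).pow_const 2
  have hmXY : Measurable fun ω => ‖X ω - (mixtureProb m v γ a ((a : ℂ) * X ω + Z ω) : ℂ) *
      gaussianPosteriorMean m v a ((a : ℂ) * X ω + Z ω)‖ ^ 2 :=
    hm.comp (by fun_prop : Measurable fun ω => (X ω, (a : ℂ) * X ω + Z ω))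
  rw [h1, amplitudeMmse_eq_integral, integral_eq_lintegral_of_nonneg_ae
    (.of_forall fun ω => by positivity) hmXY.aestronglyMeasurable,
    integral_eq_lintegral_of_nonneg_ae]
  · congr 1
    rw [lintegral_joint hX hZ hXZ hZlaw hXlaw hγ₀ hγ₁ a hm.ennreal_ofReal]
    exact lintegral_congr fun y => lintegral_norm_sub_sq_posteriorMeasure m v a hγ₀ hγ₁ y
  · refine .of_forall fun y => ?_
    have h2 := complexGaussianPDF_pos (a * m) (obsVar_pos v a) y
    have h3 : 0 ≤ 1 - mixtureProb m v γ a y :=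
      sub_nonneg.2 (mixtureProb_le_one m v a y hγ₀ hγ₁)
    simp only [Pi.zero_apply]
    positivity
  · exact Measurable.aestronglyMeasurable (by fun_prop)

/-- The density of the joint law relative to the product is the channel kernel over the output
density. Evaluated at `(X, Y)`, the log-kernel depends on `Z` only, with mean `-log π - 1`. The
right-hand side also records finiteness. -/
lemma klDiv_bernoulliGaussian (hX : Measurable X) (hZ : Measurable Z)
    (hXZ : IndepFun X Z P) (hZlaw : P.map Z = complexGaussian 0 1)
    (hXlaw : P.map X = bernoulliGaussian m v γ) (hγ₀ : 0 < γ) (hγ₁ : γ < 1) (a : ℝ) :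
    klDiv (P.map (fun ω => (X ω, (a : ℂ) * X ω + Z ω)))
        ((P.map X).prod (P.map fun ω => (a : ℂ) * X ω + Z ω)) =
      ENNReal.ofReal (expectedLogPDF m v γ 0 - expectedLogPDF m v γ a) := by
  have hY : Measurable fun ω => (a : ℂ) * X ω + Z ω := by fun_prop
  have hXY : Measurable fun ω => (X ω, (a : ℂ) * X ω + Z ω) := by fun_prop
  have := Measure.isProbabilityMeasure_map (μ := P) hX.aemeasurable
  have := Measure.isProbabilityMeasure_map (μ := P) hY.aemeasurable
  have := Measure.isProbabilityMeasure_map (μ := P) hXY.aemeasurable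
  have hk := measurable_uncurry_complexGaussianPDF a
  have hobs := map_observation hX hZ hXZ hZlaw hXlaw hγ₀ hγ₁ a
  have hr : Measurable fun p : ℂ × ℂ => ENNReal.ofReal
      (complexGaussianPDF (a * p.1) 1 p.2 / mixturePDF m v γ a p.2) :=
    (hk.div ((measurable_mixturePDF m v a).comp measurable_snd)).ennreal_ofReal
  have hjoint : P.map (fun ω => (X ω, (a : ℂ) * X ω + Z ω)) =
      ((P.map X).prod (P.map fun ω => (a : ℂ) * X ω + Z ω)).withDensity fun p =>
        ENNReal.ofReal (complexGaussianPDF (a * p.1) 1 p.2 / mixturePDF m v γ a p.2) := by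
    rw [map_prodMk_add_eq_withDensity hX hZ hXZ hZlaw, hobs,
      prod_withDensity_right (by fun_prop), ← withDensity_mul _ (by fun_prop) hr]
    congr 1
    ext p
    have hp := mixturePDF_pos m v a p.2 hγ₀ hγ₁
    rw [Pi.mul_apply, ← ENNReal.ofReal_mul hp.le, mul_div_cancel₀ _ hp.ne']
  have hac : P.map (fun ω => (X ω, (a : ℂ) * X ω + Z ω)) ≪
      (P.map X).prod (P.map fun ω => (a : ℂ) * X ω + Z ω) := by
    rw [hjoint]; exact withDensity_absolutelyContinuous _ _
  have hllr : llr (P.map fun ω => (X ω, (a : ℂ) * X ω + Z ω))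
      ((P.map X).prod (P.map fun ω => (a : ℂ) * X ω + Z ω))
      =ᵐ[P.map fun ω => (X ω, (a : ℂ) * X ω + Z ω)] fun p =>
        Real.log (complexGaussianPDF (a * p.1) 1 p.2) - Real.log (mixturePDF m v γ a p.2) := by
    -- The Radon–Nikodym derivative is known almost everywhere for the product law; absolute
    -- continuity carries this to the joint law.
    refine hac.ae_le ?_
    have := Measure.rnDeriv_withDensity
      ((P.map X).prod (P.map fun ω => (a : ℂ) * X ω + Z ω)) hr
    rw [← hjoint] at this
    filter_upwards [this] with p hp
    have h1 := complexGaussianPDF_pos (a * p.1) one_pos p.2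
    have h2 := mixturePDF_pos m v a p.2 hγ₀ hγ₁
    rw [llr, hp, ENNReal.toReal_ofReal (by positivity), Real.log_div h1.ne' h2.ne']
  have hlog : ∀ ω, Real.log (complexGaussianPDF (a * X ω) 1 ((a : ℂ) * X ω + Z ω)) =
      -Real.log Real.pi - ‖Z ω‖ ^ 2 := by
    intro ω
    unfold complexGaussianPDF
    rw [Real.log_mul (by positivity) (by positivity), Real.log_exp, add_sub_cancel_left, mul_one,
      div_one, one_div, Real.log_inv]
    ring
  have hZsq : Integrable (fun ω => ‖Z ω‖ ^ 2) P := by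
    have := integrable_norm_sq_complexGaussian 0 1
    rw [← hZlaw] at this
    exact this.comp_measurable hZ
  have hZsq' : ∫ ω, ‖Z ω‖ ^ 2 ∂P = 1 := by
    have := integral_norm_sub_sq_complexGaussian 0 0 1
    rw [← hZlaw, integral_map hZ.aemeasurable (by fun_prop)] at this
    simpa using this
  obtain ⟨hmix, hmix'⟩ := integrable_and_integral_log_mixturePDF m v a hγ₀ hγ₁
  rw [← hobs] at hmix hmix'
  have hmeas : Measurable fun p : ℂ × ℂ =>
      Real.log (complexGaussianPDF (a * p.1) 1 p.2) - Real.log (mixturePDF m v γ a p.2) :=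
    hk.log.sub ((measurable_mixturePDF m v a).comp measurable_snd).log
  have hcomp : Integrable (fun ω => Real.log (mixturePDF m v γ a ((a : ℂ) * X ω + Z ω))) P :=
    hmix.comp_measurable hY
  rw [integral_map hY.aemeasurable
    (measurable_mixturePDF m v a).log.aestronglyMeasurable] at hmix'
  have hint : Integrable (fun ω => -Real.log Real.pi - ‖Z ω‖ ^ 2) P :=
    (integrable_const _).sub hZsq
  -- For finite measures `klDiv` carries a correction by total masses, which cancels between
  -- probability measures.
  rw [klDiv_of_ac_of_integrable hac, integral_congr_ae hllr, integral_map hXY.aemeasurable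
    hmeas.aestronglyMeasurable, probReal_univ, probReal_univ, add_sub_cancel_right]
  · simp only [hlog]
    rw [integral_sub hint hcomp, hmix', integral_sub (integrable_const _) hZsq, hZsq',
      expectedLogPDF_zero]
    simp
  · rw [integrable_congr hllr, integrable_map_measure hmeas.aestronglyMeasurable
      hXY.aemeasurable]
    refine (hint.sub hcomp).congr (.of_forall fun ω => ?_)
    simp [← hlog]

end Channel

theorem theorem2 {Ω : Type*} [MeasurableSpace Ω] (P : Measure Ω) [IsProbabilityMeasure P]
    (X Z : Ω → ℂ) (hX : Measurable X) (hZ : Measurable Z) (hXZ : IndepFun X Z P)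
    (m : ℂ) (v : ℝ≥0) (γ : ℝ) (hγ₀ : 0 < γ) (hγ₁ : γ < 1)
    (hXlaw : P.map X = bernoulliGaussian m v γ)
    (hZlaw : P.map Z = complexGaussian 0 1)
    (snr : ℝ) (hsnr : 0 ≤ snr) :
    (∀ s : ℝ, 0 ≤ s → mmse P X (awgnObservation X Z s) = bgMmseIntegral m v γ s) ∧
    IntervalIntegrable (fun s => mmse P X (awgnObservation X Z s)) volume 0 snr ∧
    mutualInfoBits P X (awgnObservation X Z snr) =
      ENNReal.ofReal (Real.logb 2 (Real.exp 1) *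
        ∫ s in (0 : ℝ)..snr, mmse P X (awgnObservation X Z s)) := by
  -- Valid for every real `s`: negative values have `Real.sqrt s = 0`, and the channel lemmas accept
  -- any real amplitude. Hence the integrand can be rewritten as a function.
  have hmmse : (fun s => mmse P X (awgnObservation X Z s)) =
      fun s => amplitudeMmse m v γ (Real.sqrt s) :=
    funext fun s => mmse_eq_amplitudeMmse hX hZ hXZ hZlaw hXlaw hγ₀ hγ₁ (Real.sqrt s)
  refine ⟨fun s hs => ?_, ?_, ?_⟩
  · rw [bgMmseIntegral_eq m v hγ₀ hγ₁ hs]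
    exact congrFun hmmse s
  · rw [hmmse]
    exact ((continuous_amplitudeMmse m v hγ₀ hγ₁).comp
      Real.continuous_sqrt).intervalIntegrable _ _
  · have hlogb : 0 ≤ Real.logb 2 (Real.exp 1) :=
      Real.logb_nonneg one_lt_two (Real.one_le_exp zero_le_one)
    rw [hmmse, integral_amplitudeMmse_sqrt m v hγ₀ hγ₁ hsnr, ENNReal.ofReal_mul hlogb,
      ← klDiv_bernoulliGaussian hX hZ hXZ hZlaw hXlaw hγ₀ hγ₁]
    rfl
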